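/- Let $n\in\mathbb N$ and $\sigma>1$. For $\alpha\in\mathbb N^n$ write $|\alpha|=\sum_i\alpha_i$, $\alpha!=\prod_i\alpha_i!$. The Gevrey class $\gamma^\sigma(\mathbb R^n)$ consists of the $f\in C^\infty(\mathbb R^n)$ such that for every compact $K$ there is $C>0$ with $|\partial^\alpha f(x)|\le C^{|\alpha|+1}(\alpha!)^\sigma$ for all $\alpha\in\mathbb N^n$ and $x\in K$. The Gelfand--Shilov space $\mathcal S^{(\sigma)}(\mathbb R^n)$ consists of the $\varphi\in C^\infty(\mathbb R^n)$ such that for all $b>0$ \[ \sup_{\alpha,\beta\in\mathbb N^n}\int_{\mathbb R^n}\frac{|x^\beta|}{b^{|\alpha+\beta|}\,(\alpha!)^\sigma(\beta!)^\sigma}\,|\partial^\alpha\varphi(x)|\,dx<\infty . \] Let $\phi\in\mathcal S^{(\sigma)}(\mathbb R^n)$ satisfy $\int\phi(x)\,dx=1$ and $\int x^\alpha\phi(x)\,dx=0$ for all $\alpha\ne0$; let $\chi\in\gamma^\sigma(\mathbb R^n)$ be real-valued with $0\le\chi\le1$, $\chi(x)=0$ for $|x|\ge2$ and $\chi(x)=1$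 for $|x|\le1$; and put, for $\varepsilon\in(0,1]$, \[ \rho_\varepsilon(x)=\varepsilon^{-n}\,\phi\Bigl(\frac x\varepsilon\Bigr)\,\chi\bigl(x|\log\varepsilon|\bigr). \] Let $u\in C^\infty_c(\mathbb R^n)$ (complex-valued). Then there are a compact set $K\subset\mathbb R^n$ and $\eta\in(0,1]$ such that $\operatorname{supp}(u*\rho_\varepsilon)\subseteq K$ for all $\varepsilon\in(0,\eta]$, and the following hold. (i) There are $c>0$ and $\eta\in(0,1]$ such that \[ |\partial^\alpha(u*\rho_\varepsilon)(x)|\le c^{|\alpha|+1}(\alpha!)^\sigma\varepsilon^{-|\alpha|} \] for all $\alpha\in\mathbb N^n$, $x\in\mathbb R^n$ and $\varepsilon\in(0,\eta]$. Moreover $(u*\rho_\varepsilon)_{\varepsilon\in(0,1]}$ is $\gamma^\sigma_c$-moderate: every $u*\rho_\varepsilon$ belongs to $\gamma^\sigma(\mathbb R^n)$, for every compact $K'$ there are $c>0$ and $N\in\mathbb N$ with $|\partial^\alpha(u*\rho_\varepsilon)(x)|\le c^{|\alpha|+1}(\alpha!)^\sigma\varepsilon^{-N-|\alpha|}$ for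 all $\alpha\in\mathbb N^n$, $x\in K'$, $\varepsilon\in(0,1]$, and for all small $\varepsilon$ the supports lie in one compact set. (ii) There are a compact set $K''$ and $\eta\in(0,1]$ such that $\operatorname{supp}(u*\rho_\varepsilon-u)\subseteq K''$ for all $\varepsilon\in(0,\eta]$, and the net $(u*\rho_\varepsilon-u)_{\varepsilon\in(0,1]}$ is $C^\infty$-negligible: its members are smooth, and for every compact $K'$, every $\alpha\in\mathbb N^n$ and every $q\in\mathbb N$ there is $c>0$ with $|\partial^\alpha(u*\rho_\varepsilon-u)(x)|\le c\,\varepsilon^q$ for all $x\in K'$ and $\varepsilon\in(0,1]$. (iii) There are $c,c'>0$ and $\eta\in(0,1]$ such that \[ |\widehat{u*\rho_\varepsilon}(\xi)|\le c'\,e^{-c\,\varepsilon^{1/\sigma}\langle\xi\rangle^{1/\sigma}} \] for all $\xi\in\mathbb R^n$ and $\varepsilon\in(0,\eta]$, where $\widehat f(\xi)=\int e^{-ix\cdot\xi}f(x)\,dx$ and $\langle\xi\rangle=(1+|\xi|^2)^{1/2}$. -/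

import Mathlib

open MeasureTheory Set
open scoped ContDiff ENNReal

namespace GevreyReg

noncomputable section

/-- The length `|α| = α₁ + ⋯ + αₙ` of a multi-index. -/
def mLen {n : ℕ} (α : Fin n → ℕ) : ℕ := ∑ i, α i

/-- The factorial `α! = α₁! ⋯ αₙ!` of a multi-index. -/
def mFact {n : ℕ} (α : Fin n → ℕ) : ℕ := ∏ i, (α i).factorial

/-- The monomial `x^α = x₁^α₁ ⋯ xₙ^αₙ`. -/
def mPow {n : ℕ} (x : EuclideanSpace ℝ (Fin n)) (α : Fin n → ℕ) : ℝ := ∏ i, x i ^ α i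

/-- The first partial derivative `∂ᵢ f`. -/
def pDeriv {n : ℕ} {F : Type*} [NormedAddCommGroup F] [NormedSpace ℝ F] (i : Fin n)
    (f : EuclideanSpace ℝ (Fin n) → F) : EuclideanSpace ℝ (Fin n) → F :=
  fun x => fderiv ℝ f x (EuclideanSpace.single i 1)

/-- The partial derivative `∂^α f = ∂₁^α₁ (⋯ (∂ₙ^αₙ f))`. It is only used for smooth `f`. -/
def mDeriv {n : ℕ} {F : Type*} [NormedAddCommGroup F] [NormedSpace ℝ F] (α : Fin n → ℕ)
    (f : EuclideanSpace ℝ (Fin n) → F) : EuclideanSpace ℝ (Fin n) → F :=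
  (List.finRange n).foldr (fun i g => (pDeriv i)^[α i] g) f

/-- The Gevrey (Roumieu) class `γ^σ(ℝⁿ)`. -/
def IsGevrey {n : ℕ} {F : Type*} [NormedAddCommGroup F] [NormedSpace ℝ F] (σ : ℝ)
    (f : EuclideanSpace ℝ (Fin n) → F) : Prop :=
  ContDiff ℝ ∞ f ∧
    ∀ K : Set (EuclideanSpace ℝ (Fin n)), IsCompact K →
      ∃ C : ℝ, 0 < C ∧ ∀ (α : Fin n → ℕ), ∀ x ∈ K,
        ‖mDeriv α f x‖ ≤ C ^ (mLen α + 1) * (mFact α : ℝ) ^ σ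

/-- The extended norm
`‖φ‖_{b,σ} = sup_{α,β} ∫ |x^β| / (b^{|α+β|} α!^σ β!^σ) |∂^α φ(x)| dx ∈ [0,∞]`. -/
def gsNorm {n : ℕ} (b σ : ℝ) (φ : EuclideanSpace ℝ (Fin n) → ℂ) : ℝ≥0∞ :=
  ⨆ (α : Fin n → ℕ) (β : Fin n → ℕ), ∫⁻ x, ENNReal.ofReal
    (|mPow x β| / (b ^ mLen (α + β) * (mFact α : ℝ) ^ σ * (mFact β : ℝ) ^ σ) * ‖mDeriv α φ x‖)

/-- The Gelfand–Shilov space `𝒮^{(σ)}(ℝⁿ)` (of Beurling type). -/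
def IsGelfandShilov {n : ℕ} (σ : ℝ) (φ : EuclideanSpace ℝ (Fin n) → ℂ) : Prop :=
  ContDiff ℝ ∞ φ ∧ ∀ b : ℝ, 0 < b → gsNorm b σ φ < ⊤

/-- A mollifier `φ ∈ 𝒮^{(σ)}(ℝⁿ)`: integral one and all higher moments vanish. -/
def IsMollifier {n : ℕ} (σ : ℝ) (φ : EuclideanSpace ℝ (Fin n) → ℂ) : Prop :=
  IsGelfandShilov σ φ ∧ ∫ x, φ x = 1 ∧
    ∀ α : Fin n → ℕ, α ≠ 0 → ∫ x, (mPow x α : ℂ) * φ x = 0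

/-- A cut-off `χ ∈ γ^σ(ℝⁿ)` with `0 ≤ χ ≤ 1`, equal to `1` on the closed unit ball and to `0`
outside the open ball of radius `2`. -/
def IsCutoff {n : ℕ} (σ : ℝ) (χ : EuclideanSpace ℝ (Fin n) → ℝ) : Prop :=
  IsGevrey σ χ ∧ (∀ x, 0 ≤ χ x ∧ χ x ≤ 1) ∧
    (∀ x, 2 ≤ ‖x‖ → χ x = 0) ∧ (∀ x, ‖x‖ ≤ 1 → χ x = 1)

/-- `ρ_ε(x) = ε^{-n} φ(x/ε) χ(x |log ε|)`. -/
def rho {n : ℕ} (φ : EuclideanSpace ℝ (Fin n) → ℂ) (χ : EuclideanSpace ℝ (Fin n) → ℝ) (ε : ℝ) :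
    EuclideanSpace ℝ (Fin n) → ℂ :=
  fun x => ((ε ^ n)⁻¹ : ℝ) * φ (ε⁻¹ • x) * (χ (|Real.log ε| • x) : ℂ)

/-- The convolution `(f ∗ g)(x) = ∫ f(y) g(x - y) dy`. -/
def conv {n : ℕ} (f g : EuclideanSpace ℝ (Fin n) → ℂ) : EuclideanSpace ℝ (Fin n) → ℂ :=
  MeasureTheory.convolution f g (ContinuousLinearMap.mul ℝ ℂ) volume

/-- The Fourier transform `f̂(ξ) = ∫ e^{-i x·ξ} f(x) dx`, in the normalisation for which
`(D^α f)^(ξ) = ξ^α f̂(ξ)` with `D = -i∂`. -/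
def fourierHat {n : ℕ} (f : EuclideanSpace ℝ (Fin n) → ℂ) (ξ : EuclideanSpace ℝ (Fin n)) : ℂ :=
  ∫ x, Complex.exp (-Complex.I * (inner ℝ x ξ : ℝ)) * f x

/-- The bracket `⟨ξ⟩ = (1 + |ξ|²)^{1/2}`. -/
def jap {n : ℕ} (ξ : EuclideanSpace ℝ (Fin n)) : ℝ := Real.sqrt (1 + ‖ξ‖ ^ 2)

/-- For all small `ε` the supports of the members of a net lie in one compact set. -/
def UniformCompactSupport {n : ℕ} (v : ℝ → EuclideanSpace ℝ (Fin n) → ℂ) : Prop :=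
  ∃ K : Set (EuclideanSpace ℝ (Fin n)), IsCompact K ∧
    ∃ η ∈ Ioc (0 : ℝ) 1, ∀ ε ∈ Ioc (0 : ℝ) η, tsupport (v ε) ⊆ K

/-- `γ^σ`-moderate nets `(v_ε)`, `ε ∈ (0,1]`. -/
def IsGevreyModerate {n : ℕ} (σ : ℝ) (v : ℝ → EuclideanSpace ℝ (Fin n) → ℂ) : Prop :=
  (∀ ε ∈ Ioc (0 : ℝ) 1, IsGevrey σ (v ε)) ∧
    ∀ K : Set (EuclideanSpace ℝ (Fin n)), IsCompact K →
      ∃ c : ℝ, 0 < c ∧ ∃ N : ℕ, ∀ (α : Fin n → ℕ), ∀ x ∈ K, ∀ ε ∈ Ioc (0 : ℝ) 1,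
        ‖mDeriv α (v ε) x‖ ≤
          c ^ (mLen α + 1) * (mFact α : ℝ) ^ σ * ε ^ (-(N : ℤ) - (mLen α : ℤ))

/-- `γ^σ_c`-moderate nets: `γ^σ`-moderate, with supports in one compact set for small `ε`. -/
def IsGevreyModerateC {n : ℕ} (σ : ℝ) (v : ℝ → EuclideanSpace ℝ (Fin n) → ℂ) : Prop :=
  IsGevreyModerate σ v ∧ UniformCompactSupport v

/-- `C^∞`-negligible nets `(v_ε)`, `ε ∈ (0,1]`. -/
def IsSmoothNegligible {n : ℕ} (v : ℝ → EuclideanSpace ℝ (Fin n) → ℂ) : Prop :=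
  (∀ ε ∈ Ioc (0 : ℝ) 1, ContDiff ℝ ∞ (v ε)) ∧
    ∀ K : Set (EuclideanSpace ℝ (Fin n)), IsCompact K → ∀ (α : Fin n → ℕ) (q : ℕ),
      ∃ c : ℝ, 0 < c ∧ ∀ x ∈ K, ∀ ε ∈ Ioc (0 : ℝ) 1, ‖mDeriv α (v ε) x‖ ≤ c * ε ^ q

end

end GevreyReg

/-! Everything follows from two ways of differentiating the convolution. Putting all derivatives on
the mollifier gives |∂^α(u∗ρ_ε)| ≤ sup|u| · ‖∂^α ρ_ε‖_{L¹}. By Leibniz, ∂^α ρ_ε is a sum of 2^|α|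
products. A derivative of φ(x/ε) costs ε⁻¹, a derivative of χ(x|log ε|) costs |log ε| ≤ ε⁻¹, and
β!γ! ≤ (β+γ)! merges the two factorial bounds (`exists_integral_mDeriv_rho_le`). This is the Gevrey
estimate, valid for all ε ∈ (0,1].

Putting all derivatives on u reduces negligibility to the estimate of v∗ρ_ε − v for v = ∂^α u. After
y = εz the Taylor polynomial of v integrates against φ to v(x), because the higher moments vanish.
What remains is the Taylor remainder, O(ε^{q+1}), and the effect of the cut-off, controlled by
(ε|log ε|)^{2q} ≤ 4^q ε^q (`exists_norm_conv_rho_sub_le`).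

For the Fourier transform, the Gevrey estimate for pure derivatives and the uniform support give
(ε|ξ_i|)^m |F| ≤ C^{m+1} m!^σ for all m. Summing over m after taking σ-th roots turns this into
exponential decay (`le_exp_of_forall_pow_mul_le`), and the coordinate with largest |ξ_i| yields the
decay in ⟨ξ⟩. -/

namespace GevreyReg

/-! ### Multi-index calculus for iterated partial derivatives. -/

section Calculus

variable {n : ℕ} {F : Type*} [NormedAddCommGroup F] [NormedSpace ℝ F]

theorem contDiff_pDeriv {f : EuclideanSpace ℝ (Fin n) → F} (hf : ContDiff ℝ ∞ f) (i : Fin n) :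
    ContDiff ℝ ∞ (pDeriv i f) := by
  have h : ContDiff ℝ ∞ (fderiv ℝ f) := hf.fderiv_right (by simp)
  exact h.clm_apply contDiff_const

theorem contDiff_pDeriv_iterate {f : EuclideanSpace ℝ (Fin n) → F} (hf : ContDiff ℝ ∞ f)
    (i : Fin n) (k : ℕ) : ContDiff ℝ ∞ ((pDeriv i)^[k] f) := by
  induction k with
  | zero => simpa using hf
  | succ k ih => rw [Function.iterate_succ_apply']; exact contDiff_pDeriv ih i

/-- Successive partial derivatives in the directions of a list. -/
noncomputable def listDeriv (l : List (Fin n)) (α : Fin n → ℕ)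
    (f : EuclideanSpace ℝ (Fin n) → F) : EuclideanSpace ℝ (Fin n) → F :=
  l.foldr (fun i g => (pDeriv i)^[α i] g) f

theorem contDiff_listDeriv {f : EuclideanSpace ℝ (Fin n) → F} (hf : ContDiff ℝ ∞ f)
    (l : List (Fin n)) (α : Fin n → ℕ) : ContDiff ℝ ∞ (listDeriv l α f) := by
  induction l with
  | nil => exact hf
  | cons i l ih => exact contDiff_pDeriv_iterate ih i _

theorem contDiff_mDeriv {f : EuclideanSpace ℝ (Fin n) → F} (hf : ContDiff ℝ ∞ f)
    (α : Fin n → ℕ) : ContDiff ℝ ∞ (mDeriv α f) :=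
  contDiff_listDeriv hf _ α

theorem pDeriv_comm {f : EuclideanSpace ℝ (Fin n) → F} (hf : ContDiff ℝ ∞ f) (i j : Fin n) :
    pDeriv i (pDeriv j f) = pDeriv j (pDeriv i f) := by
  have h : Differentiable ℝ (fderiv ℝ f) :=
    (hf.fderiv_right (m := ∞) (by simp)).differentiable (by simp)
  have key (i j : Fin n) (x : EuclideanSpace ℝ (Fin n)) : pDeriv i (pDeriv j f) x =
      fderiv ℝ (fderiv ℝ f) x (EuclideanSpace.single i 1) (EuclideanSpace.single j 1) := by
    unfold pDeriv
    rw [fderiv_clm_apply (h x) (differentiableAt_const _)]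
    simp
  funext x
  rw [key, key]
  exact ((contDiff_infty.1 hf 2).contDiffAt.isSymmSndFDerivAt (by simp)) _ _

theorem pDeriv_iterate_comm {f : EuclideanSpace ℝ (Fin n) → F} (hf : ContDiff ℝ ∞ f)
    (i j : Fin n) (k : ℕ) : pDeriv i ((pDeriv j)^[k] f) = (pDeriv j)^[k] (pDeriv i f) := by
  induction k with
  | zero => rfl
  | succ k ih =>
    rw [Function.iterate_succ_apply', Function.iterate_succ_apply',
      pDeriv_comm (contDiff_pDeriv_iterate hf j k), ih]

theorem listDeriv_add_single_of_notMem {i : Fin n} {l : List (Fin n)} (hi : i ∉ l)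
    (α : Fin n → ℕ) (f : EuclideanSpace ℝ (Fin n) → F) :
    listDeriv l (α + Pi.single i 1) f = listDeriv l α f := by
  induction l with
  | nil => rfl
  | cons j l ih =>
    simp only [List.mem_cons, not_or] at hi
    change (pDeriv j)^[(α + Pi.single i 1 : Fin n → ℕ) j] (listDeriv l _ f) = (pDeriv j)^[α j] (listDeriv l _ f)
    rw [ih hi.2]
    simp [Pi.single_eq_of_ne (Ne.symm hi.1)]

/-- A general list replaces `List.finRange n` so that induction applies. Without repetitions the
exponent of `i` is used at one place only, and the extra derivative commutes outwards from there. -/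
theorem listDeriv_add_single {f : EuclideanSpace ℝ (Fin n) → F} (hf : ContDiff ℝ ∞ f) {i : Fin n}
    {l : List (Fin n)} (hl : l.Nodup) (hi : i ∈ l) (α : Fin n → ℕ) :
    listDeriv l (α + Pi.single i 1) f = pDeriv i (listDeriv l α f) := by
  induction l with
  | nil => simp at hi
  | cons j l ih =>
    rw [List.nodup_cons] at hl
    change (pDeriv j)^[(α + Pi.single i 1 : Fin n → ℕ) j] (listDeriv l _ f) =
      pDeriv i ((pDeriv j)^[α j] (listDeriv l α f))
    by_cases hij : i = j
    · subst hij
      rw [listDeriv_add_single_of_notMem hl.1]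
      simp [← Function.iterate_succ_apply' (pDeriv i)]
    · rw [ih hl.2 (by simpa [hij] using hi), pDeriv_iterate_comm (contDiff_listDeriv hf l α)]
      simp [Pi.single_eq_of_ne (Ne.symm hij)]

theorem mDeriv_add_single {f : EuclideanSpace ℝ (Fin n) → F} (hf : ContDiff ℝ ∞ f) (i : Fin n)
    (α : Fin n → ℕ) : mDeriv (α + Pi.single i 1) f = pDeriv i (mDeriv α f) :=
  listDeriv_add_single hf (List.nodup_finRange n) (List.mem_finRange i) α

@[simp] theorem mDeriv_zero (f : EuclideanSpace ℝ (Fin n) → F) : mDeriv 0 f = f := by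
  change (List.finRange n).foldr _ f = f
  induction List.finRange n with
  | nil => rfl
  | cons i l ih => simp

@[simp] theorem mLen_zero : mLen (0 : Fin n → ℕ) = 0 := by simp [mLen]

theorem mLen_add (α β : Fin n → ℕ) : mLen (α + β) = mLen α + mLen β := by
  simp [mLen, Finset.sum_add_distrib]

@[simp] theorem mLen_single (i : Fin n) (k : ℕ) : mLen (Pi.single i k) = k := by
  simp [mLen]

/-- Together with `mDeriv_add_single` this reduces rules for `mDeriv` to rules for a single partial
derivative. -/
theorem multiIndex_induction {P : (Fin n → ℕ) → Prop} (zero : P 0)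
    (add : ∀ α i, P α → P (α + Pi.single i 1)) (α : Fin n → ℕ) : P α := by
  induction h : mLen α generalizing α with
  | zero =>
    have : α = 0 := by
      funext i
      simpa using (Finset.sum_eq_zero_iff.1 h) i (Finset.mem_univ i)
    exact this ▸ zero
  | succ k ih =>
    obtain ⟨i, hi⟩ : ∃ i, α i ≠ 0 := by
      by_contra! hc
      have : α = 0 := funext hc
      simp [this] at h
    have hα : α = (α - Pi.single i 1) + Pi.single i 1 := by
      funext j
      by_cases hj : j = i
      · subst hj; simp; omega
      · simp [Pi.single_eq_of_ne hj]
    rw [hα]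
    refine add _ _ (ih _ ?_)
    have := congrArg mLen hα
    rw [mLen_add, mLen_single] at this
    omega

theorem mFact_pos (α : Fin n → ℕ) : 0 < mFact α :=
  Finset.prod_pos fun i _ => (α i).factorial_pos

theorem mFact_mul_le (α β : Fin n → ℕ) : mFact α * mFact β ≤ mFact (α + β) := by
  unfold mFact
  rw [← Finset.prod_mul_distrib]
  exact Finset.prod_le_prod' fun i _ =>
    Nat.le_of_dvd (Nat.factorial_pos _) (Nat.factorial_mul_factorial_dvd_factorial_add _ _)

theorem mDeriv_single {f : EuclideanSpace ℝ (Fin n) → F} (hf : ContDiff ℝ ∞ f) (i : Fin n)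
    (k : ℕ) : mDeriv (Pi.single i k) f = (pDeriv i)^[k] f := by
  induction k with
  | zero => simp
  | succ k ih =>
    rw [Pi.single_add, mDeriv_add_single hf, ih, Function.iterate_succ_apply']

theorem pDeriv_mul {f g : EuclideanSpace ℝ (Fin n) → ℂ} (hf : ContDiff ℝ ∞ f)
    (hg : ContDiff ℝ ∞ g) (i : Fin n) (x : EuclideanSpace ℝ (Fin n)) :
    pDeriv i (fun x => f x * g x) x = pDeriv i f x * g x + f x * pDeriv i g x := by
  unfold pDeriv
  rw [fderiv_fun_mul (hf.differentiable (by simp) x) (hg.differentiable (by simp) x)]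
  simp only [add_apply, smul_apply, smul_eq_mul]
  ring

/-- The Leibniz rule, with the terms listed without collecting the binomial coefficients. -/
theorem exists_mDeriv_mul (α : Fin n → ℕ) : ∃ (ι : Type) (_ : Fintype ι) (a b : ι → Fin n → ℕ),
    Fintype.card ι = 2 ^ mLen α ∧ (∀ k, a k + b k = α) ∧
    ∀ f g : EuclideanSpace ℝ (Fin n) → ℂ, ContDiff ℝ ∞ f → ContDiff ℝ ∞ g →
      mDeriv α (fun x => f x * g x) = fun x => ∑ k, mDeriv (a k) f x * mDeriv (b k) g x := by
  induction α using multiIndex_induction with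
  | zero => exact ⟨Unit, inferInstance, fun _ => 0, fun _ => 0, by simp, by simp, by simp⟩
  | add α i ih =>
    obtain ⟨ι, _, a, b, hc, hab, H⟩ := ih
    -- One more derivative splits each term in two, according to the factor it hits.
    refine ⟨ι ⊕ ι, inferInstance, Sum.elim (fun k => a k + Pi.single i 1) a,
      Sum.elim b (fun k => b k + Pi.single i 1), ?_, ?_, ?_⟩
    · rw [Fintype.card_sum, hc, mLen_add, mLen_single]; ring
    · rintro (k | k)
      · simp [← hab k, add_right_comm]
      · simp [← hab k, add_assoc]
    · intro f g hf hg
      rw [mDeriv_add_single (hf.mul hg), H f g hf hg]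
      funext x
      have hd (k : ι) : DifferentiableAt ℝ (fun x => mDeriv (a k) f x * mDeriv (b k) g x) x :=
        (((contDiff_mDeriv hf _).mul (contDiff_mDeriv hg _)).differentiable (by simp)) x
      have h1 : pDeriv i (fun x => ∑ k, mDeriv (a k) f x * mDeriv (b k) g x) x =
          ∑ k, pDeriv i (fun x => mDeriv (a k) f x * mDeriv (b k) g x) x := by
        unfold pDeriv
        rw [fderiv_fun_sum fun k _ => hd k]
        simp
      rw [h1, Fintype.sum_sum_type, ← Finset.sum_add_distrib]
      refine Finset.sum_congr rfl fun k _ => ?_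
      rw [pDeriv_mul (contDiff_mDeriv hf _) (contDiff_mDeriv hg _)]
      simp [mDeriv_add_single hf, mDeriv_add_single hg]

theorem pDeriv_const_smul {f : EuclideanSpace ℝ (Fin n) → F} (hf : ContDiff ℝ ∞ f) (i : Fin n)
    (c : ℝ) : pDeriv i (fun x => c • f x) = fun x => c • pDeriv i f x := by
  funext x
  unfold pDeriv
  rw [fderiv_fun_const_smul (hf.differentiable (by simp) x)]
  simp

theorem pDeriv_comp_smul {f : EuclideanSpace ℝ (Fin n) → F} (i : Fin n)
    (c : ℝ) : pDeriv i (fun x => f (c • x)) = fun x => c • pDeriv i f (c • x) := by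
  funext x
  unfold pDeriv
  rw [fderiv_comp_smul]
  simp

theorem mDeriv_comp_smul {f : EuclideanSpace ℝ (Fin n) → F} (hf : ContDiff ℝ ∞ f) (c : ℝ)
    (α : Fin n → ℕ) :
    mDeriv α (fun x => f (c • x)) = fun x => c ^ mLen α • mDeriv α f (c • x) := by
  induction α using multiIndex_induction with
  | zero => simp
  | add α i ih =>
    have h1 : ContDiff ℝ ∞ (fun x => mDeriv α f (c • x)) :=
      (contDiff_mDeriv hf α).comp (contDiff_const_smul c)
    have h2 : ContDiff ℝ ∞ (fun x => f (c • x)) := hf.comp (contDiff_const_smul c)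
    rw [mDeriv_add_single h2, ih, pDeriv_const_smul h1,
      pDeriv_comp_smul, mDeriv_add_single hf, mLen_add, mLen_single]
    simp [pow_succ, mul_smul]

theorem mDeriv_const_smul {f : EuclideanSpace ℝ (Fin n) → F} (hf : ContDiff ℝ ∞ f) (c : ℝ)
    (α : Fin n → ℕ) : mDeriv α (fun x => c • f x) = fun x => c • mDeriv α f x := by
  induction α using multiIndex_induction with
  | zero => simp
  | add α i ih =>
    rw [mDeriv_add_single (hf.const_smul c), ih, pDeriv_const_smul (contDiff_mDeriv hf α),
      mDeriv_add_single hf]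

theorem mDeriv_sub {f g : EuclideanSpace ℝ (Fin n) → F} (hf : ContDiff ℝ ∞ f)
    (hg : ContDiff ℝ ∞ g) (α : Fin n → ℕ) :
    mDeriv α (fun x => f x - g x) = fun x => mDeriv α f x - mDeriv α g x := by
  induction α using multiIndex_induction with
  | zero => simp
  | add α i ih =>
    rw [mDeriv_add_single (hf.sub hg), ih, mDeriv_add_single hf, mDeriv_add_single hg]
    funext x
    unfold pDeriv
    rw [fderiv_fun_sub ((contDiff_mDeriv hf α).differentiable (by simp) x)
      ((contDiff_mDeriv hg α).differentiable (by simp) x)]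
    simp

theorem mDeriv_ofReal {f : EuclideanSpace ℝ (Fin n) → ℝ} (hf : ContDiff ℝ ∞ f) (α : Fin n → ℕ) :
    mDeriv α (fun x => (f x : ℂ)) = fun x => ((mDeriv α f x : ℝ) : ℂ) := by
  induction α using multiIndex_induction with
  | zero => simp
  | add α i ih =>
    have h2 : ContDiff ℝ ∞ (fun x => (f x : ℂ)) := Complex.ofRealCLM.contDiff.comp hf
    rw [mDeriv_add_single h2, ih, mDeriv_add_single hf]
    funext x
    unfold pDeriv
    have := (Complex.ofRealCLM.hasFDerivAt.comp x
      ((contDiff_mDeriv hf α).differentiable (by simp) x).hasFDerivAt).fderiv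
    change fderiv ℝ (Complex.ofRealCLM ∘ mDeriv α f) x _ = _
    rw [this]
    simp

theorem tsupport_pDeriv_subset (f : EuclideanSpace ℝ (Fin n) → F) (i : Fin n) :
    tsupport (pDeriv i f) ⊆ tsupport f :=
  tsupport_fderiv_apply_subset ℝ _

theorem tsupport_mDeriv_subset {f : EuclideanSpace ℝ (Fin n) → F} (hf : ContDiff ℝ ∞ f)
    (α : Fin n → ℕ) : tsupport (mDeriv α f) ⊆ tsupport f := by
  induction α using multiIndex_induction with
  | zero => simp
  | add α i ih =>
    rw [mDeriv_add_single hf]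
    exact (tsupport_pDeriv_subset _ i).trans ih

theorem hasCompactSupport_mDeriv {f : EuclideanSpace ℝ (Fin n) → F} (hf : ContDiff ℝ ∞ f)
    (hc : HasCompactSupport f) (α : Fin n → ℕ) : HasCompactSupport (mDeriv α f) :=
  hc.of_isClosed_subset (isClosed_tsupport _) (tsupport_mDeriv_subset hf α)

end Calculus

/-! ### Derivatives, supports and Fourier transforms of convolutions. -/

section Convolution

variable {n : ℕ} {u g : EuclideanSpace ℝ (Fin n) → ℂ}

theorem conv_apply (u g : EuclideanSpace ℝ (Fin n) → ℂ) (x : EuclideanSpace ℝ (Fin n)) :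
    conv u g x = ∫ y, u y * g (x - y) := rfl

theorem conv_apply_swap (u g : EuclideanSpace ℝ (Fin n) → ℂ) (x : EuclideanSpace ℝ (Fin n)) :
    conv u g x = ∫ y, u (x - y) * g y :=
  convolution_eq_swap _

theorem contDiff_conv (hu : ContDiff ℝ ∞ u) (huc : HasCompactSupport u) (hg : Continuous g) :
    ContDiff ℝ ∞ (conv u g) :=
  huc.contDiff_convolution_left _ hu hg.locallyIntegrable

theorem pDeriv_conv_left (hu : ContDiff ℝ ∞ u) (huc : HasCompactSupport u) (hg : Continuous g)
    (i : Fin n) : pDeriv i (conv u g) = conv (pDeriv i u) g := by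
  funext x
  have h1 := huc.hasFDerivAt_convolution_left (ContinuousLinearMap.mul ℝ ℂ)
    (contDiff_infty.1 hu 1) (hg.locallyIntegrable (μ := volume)) x
  have h2 : ConvolutionExistsAt (fderiv ℝ u) g x
      ((ContinuousLinearMap.mul ℝ ℂ).precompL (EuclideanSpace ℝ (Fin n))) volume :=
    (huc.fderiv ℝ).convolutionExists_left _ (hu.continuous_fderiv (by simp))
      hg.locallyIntegrable x
  change fderiv ℝ (conv u g) x _ = _
  unfold conv
  rw [h1.fderiv, convolution_def, ContinuousLinearMap.integral_apply h2]
  rfl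

theorem integrable_mul_of_hasCompactSupport_left {f g : EuclideanSpace ℝ (Fin n) → ℂ}
    (hf : Continuous f) (hfc : HasCompactSupport f) (hg : Continuous g) :
    Integrable fun x => f x * g x :=
  (hf.mul hg).integrable_of_hasCompactSupport (hfc.mul_right)

theorem continuous_pDeriv {f : EuclideanSpace ℝ (Fin n) → ℂ} (hf : ContDiff ℝ ∞ f) (i : Fin n) :
    Continuous (pDeriv i f) :=
  (contDiff_pDeriv hf i).continuous

theorem hasCompactSupport_pDeriv {f : EuclideanSpace ℝ (Fin n) → ℂ} (hf : HasCompactSupport f)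
    (i : Fin n) : HasCompactSupport (pDeriv i f) :=
  hf.fderiv_apply ℝ _

/-- Compact support of `f` alone makes all the products integrable, so `g` may be a translate of the
mollifier or an oscillating exponential. -/
theorem integral_mul_pDeriv {f g : EuclideanSpace ℝ (Fin n) → ℂ} (hf : ContDiff ℝ ∞ f)
    (hfc : HasCompactSupport f) (hg : ContDiff ℝ ∞ g) (i : Fin n) :
    ∫ x, f x * pDeriv i g x = -∫ x, pDeriv i f x * g x :=
  integral_mul_fderiv_eq_neg_fderiv_mul_of_integrable
    (integrable_mul_of_hasCompactSupport_left (continuous_pDeriv hf i)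
      (hasCompactSupport_pDeriv hfc i) hg.continuous)
    (integrable_mul_of_hasCompactSupport_left hf.continuous hfc (continuous_pDeriv hg i))
    (integrable_mul_of_hasCompactSupport_left hf.continuous hfc hg.continuous)
    (fun x _ => hf.differentiable (by simp) x) (fun x _ => hg.differentiable (by simp) x)

theorem conv_pDeriv_right (hu : ContDiff ℝ ∞ u) (huc : HasCompactSupport u) (hg : ContDiff ℝ ∞ g)
    (i : Fin n) : conv u (pDeriv i g) = conv (pDeriv i u) g := by
  funext x
  have h : ContDiff ℝ ∞ (fun y => g (x - y)) := hg.comp (contDiff_const.sub contDiff_id)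
  have hd (y : EuclideanSpace ℝ (Fin n)) :
      pDeriv i (fun y => g (x - y)) y = - pDeriv i g (x - y) := by
    unfold pDeriv
    have := ((hg.differentiable (by simp) (x - y)).hasFDerivAt.comp y
      ((hasFDerivAt_const x y).sub (hasFDerivAt_id y))).fderiv
    change fderiv ℝ (g ∘ fun y => x - y) y _ = _
    change fderiv ℝ (g ∘ fun y => x - y) y = _ at this
    rw [this]
    simp
  have := integral_mul_pDeriv hu huc h i
  simp only [hd, mul_neg, integral_neg, neg_inj] at this
  exact this

theorem mDeriv_conv_left (hu : ContDiff ℝ ∞ u) (huc : HasCompactSupport u) (hg : Continuous g)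
    (α : Fin n → ℕ) : mDeriv α (conv u g) = conv (mDeriv α u) g := by
  induction α using multiIndex_induction with
  | zero => simp
  | add α i ih =>
    rw [mDeriv_add_single (contDiff_conv hu huc hg), ih, mDeriv_add_single hu,
      pDeriv_conv_left (contDiff_mDeriv hu α) (hasCompactSupport_mDeriv hu huc α) hg]

/-- Each derivative first falls on the compactly supported factor and is then moved to `g` by parts,
so no decay of `g` is needed. -/
theorem mDeriv_conv_right (hu : ContDiff ℝ ∞ u) (huc : HasCompactSupport u) (hg : ContDiff ℝ ∞ g)
    (α : Fin n → ℕ) : mDeriv α (conv u g) = conv u (mDeriv α g) := by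
  induction α using multiIndex_induction with
  | zero => simp
  | add α i ih =>
    rw [mDeriv_add_single (contDiff_conv hu huc hg.continuous), ih, mDeriv_add_single hg,
      pDeriv_conv_left hu huc (contDiff_mDeriv hg α).continuous,
      conv_pDeriv_right hu huc (contDiff_mDeriv hg α)]

theorem norm_conv_le {A : ℝ} (hu : ∀ y, ‖u y‖ ≤ A) (hg : Integrable g)
    (x : EuclideanSpace ℝ (Fin n)) : ‖conv u g x‖ ≤ A * ∫ y, ‖g y‖ := by
  rw [conv_apply_swap, ← integral_const_mul]
  refine norm_integral_le_of_norm_le (hg.norm.const_mul A) (.of_forall fun y => ?_)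
  rw [norm_mul]
  exact mul_le_mul_of_nonneg_right (hu _) (norm_nonneg _)

theorem exists_norm_le_of_hasCompactSupport (hu : Continuous u) (huc : HasCompactSupport u) :
    ∃ A : ℝ, 0 < A ∧ ∀ y, ‖u y‖ ≤ A := by
  obtain ⟨A, hA⟩ := huc.exists_bound_of_continuous hu
  exact ⟨max A 1, by positivity, fun y => (hA y).trans (le_max_left _ _)⟩

open scoped Pointwise in
theorem tsupport_conv_subset {K : Set (EuclideanSpace ℝ (Fin n))} (huc : HasCompactSupport u)
    (hK : IsCompact K) (hg : Function.support g ⊆ K) : tsupport (conv u g) ⊆ tsupport u + K :=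
  closure_minimal ((support_convolution_subset _).trans
    (Set.add_subset_add (subset_tsupport u) hg)) (huc.isCompact.add hK).isClosed

theorem fourierHat_pDeriv {f : EuclideanSpace ℝ (Fin n) → ℂ} (hf : ContDiff ℝ ∞ f)
    (hfc : HasCompactSupport f) (i : Fin n) (ξ : EuclideanSpace ℝ (Fin n)) :
    fourierHat (pDeriv i f) ξ = Complex.I * (ξ i : ℝ) * fourierHat f ξ := by
  have he : ContDiff ℝ ∞ (fun x : EuclideanSpace ℝ (Fin n) =>
      Complex.exp (-Complex.I * (inner ℝ x ξ : ℝ))) :=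
    (contDiff_const.mul (Complex.ofRealCLM.contDiff.comp
      (contDiff_id.inner ℝ contDiff_const))).cexp
  have hd (x : EuclideanSpace ℝ (Fin n)) :
      pDeriv i (fun x => Complex.exp (-Complex.I * (inner ℝ x ξ : ℝ))) x =
        -(Complex.I * (ξ i : ℝ)) * Complex.exp (-Complex.I * (inner ℝ x ξ : ℝ)) := by
    unfold pDeriv
    have h1 : HasFDerivAt (fun x : EuclideanSpace ℝ (Fin n) => ((inner ℝ x ξ : ℝ) : ℂ))
        (Complex.ofRealCLM ∘L (innerSL ℝ ξ)) x := by
      have := (Complex.ofRealCLM ∘L (innerSL ℝ ξ)).hasFDerivAt (x := x)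
      refine this.congr_of_eventuallyEq (.of_forall fun y => ?_)
      simp [real_inner_comm]
    rw [((h1.const_mul (-Complex.I)).cexp).fderiv]
    simp [EuclideanSpace.inner_single_right]
    ring
  have h := integral_mul_pDeriv hf hfc he i
  simp only [hd] at h
  have h2 : fourierHat (pDeriv i f) ξ =
      ∫ x, pDeriv i f x * Complex.exp (-Complex.I * (inner ℝ x ξ : ℝ)) := by
    simp only [fourierHat, mul_comm]
  rw [h2, eq_comm, ← neg_inj, ← h, fourierHat, ← integral_const_mul, ← integral_neg]
  congr 1
  funext x
  ring

theorem fourierHat_pDeriv_iterate {f : EuclideanSpace ℝ (Fin n) → ℂ} (hf : ContDiff ℝ ∞ f)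
    (hfc : HasCompactSupport f) (i : Fin n) (ξ : EuclideanSpace ℝ (Fin n)) (k : ℕ) :
    fourierHat ((pDeriv i)^[k] f) ξ = (Complex.I * (ξ i : ℝ)) ^ k * fourierHat f ξ := by
  induction k generalizing f with
  | zero => simp
  | succ k ih =>
    rw [Function.iterate_succ_apply, ih (contDiff_pDeriv hf i) (hasCompactSupport_pDeriv hfc i),
      fourierHat_pDeriv hf hfc]
    ring

theorem norm_fourierHat_le_of_support_subset {f : EuclideanSpace ℝ (Fin n) → ℂ}
    {K : Set (EuclideanSpace ℝ (Fin n))} (hK : IsCompact K) (hf : tsupport f ⊆ K) {A : ℝ}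
    (hA : ∀ x, ‖f x‖ ≤ A) (ξ : EuclideanSpace ℝ (Fin n)) :
    ‖fourierHat f ξ‖ ≤ A * volume.real K := by
  have h : fourierHat f ξ = ∫ x in K, Complex.exp (-Complex.I * (inner ℝ x ξ : ℝ)) * f x := by
    refine (setIntegral_eq_integral_of_forall_compl_eq_zero fun x hx => ?_).symm
    rw [image_eq_zero_of_notMem_tsupport fun h => hx (hf h), mul_zero]
  rw [h]
  refine norm_setIntegral_le_of_norm_le_const hK.measure_lt_top fun x _ => ?_
  rw [norm_mul]
  simpa [Complex.norm_exp] using hA x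

end Convolution

/-! ### Integrability and vanishing moments of the mollifier. -/

section Moments

variable {n : ℕ} {σ : ℝ} {φ : EuclideanSpace ℝ (Fin n) → ℂ}

theorem continuous_mPow (β : Fin n → ℕ) :
    Continuous fun x : EuclideanSpace ℝ (Fin n) => mPow x β := by
  unfold mPow
  fun_prop

theorem mPow_zero (x : EuclideanSpace ℝ (Fin n)) : mPow x 0 = 1 := by simp [mPow]

theorem mFact_rpow_pos (α : Fin n → ℕ) (σ : ℝ) : 0 < (mFact α : ℝ) ^ σ :=
  Real.rpow_pos_of_pos (by exact_mod_cast mFact_pos α) σ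

/-- The single value b = 1 suffices: the supremum defining `gsNorm` dominates each of its integrals.
-/
theorem IsGelfandShilov.integrable_and_integral_le (hφ : IsGelfandShilov σ φ)
    (α β : Fin n → ℕ) :
    Integrable (fun x => |mPow x β| * ‖mDeriv α φ x‖) ∧
      ∫ x, |mPow x β| * ‖mDeriv α φ x‖ ≤
        (gsNorm 1 σ φ).toReal * ((mFact α : ℝ) ^ σ * (mFact β : ℝ) ^ σ) := by
  set D : ℝ := (mFact α : ℝ) ^ σ * (mFact β : ℝ) ^ σ with hD
  have hDpos : 0 < D := mul_pos (mFact_rpow_pos α σ) (mFact_rpow_pos β σ)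
  set h : EuclideanSpace ℝ (Fin n) → ℝ := fun x => |mPow x β| / D * ‖mDeriv α φ x‖ with hh
  have hcont : Continuous h :=
    ((continuous_mPow β).abs.div_const D).mul (contDiff_mDeriv hφ.1 α).continuous.norm
  have hnonneg (x) : 0 ≤ h x := by positivity
  have hfin := hφ.2 1 one_pos
  have hle : ∫⁻ x, ENNReal.ofReal (h x) ≤ gsNorm 1 σ φ := by
    have := le_iSup₂ (f := fun α β : Fin n → ℕ => ∫⁻ x, ENNReal.ofReal
      (|mPow x β| / ((1 : ℝ) ^ mLen (α + β) * (mFact α : ℝ) ^ σ * (mFact β : ℝ) ^ σ) *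
        ‖mDeriv α φ x‖)) α β
    simpa only [gsNorm, one_pow, one_mul, hh, hD] using this
  have hint : Integrable h := by
    refine ⟨hcont.aestronglyMeasurable, ?_⟩
    rw [hasFiniteIntegral_iff_ofReal (.of_forall hnonneg)]
    exact hle.trans_lt hfin
  have heq : (fun x => |mPow x β| * ‖mDeriv α φ x‖) = fun x => D * h x := by
    funext x
    simp only [hh]
    field_simp
  rw [heq, integral_const_mul, mul_comm]
  refine ⟨hint.const_mul D, mul_le_mul_of_nonneg_right ?_ hDpos.le⟩
  rw [integral_eq_lintegral_of_nonneg_ae (.of_forall hnonneg) hcont.aestronglyMeasurable]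
  exact ENNReal.toReal_mono hfin.ne hle

theorem IsGelfandShilov.integrable_mDeriv (hφ : IsGelfandShilov σ φ) (α : Fin n → ℕ) :
    Integrable (mDeriv α φ) := by
  have := (hφ.integrable_and_integral_le α 0).1
  simp only [mPow_zero, abs_one, one_mul] at this
  exact (integrable_norm_iff (contDiff_mDeriv hφ.1 α).continuous.aestronglyMeasurable).1 this

theorem IsGelfandShilov.integral_mDeriv_le (hφ : IsGelfandShilov σ φ) (α : Fin n → ℕ) :
    ∫ x, ‖mDeriv α φ x‖ ≤ (gsNorm 1 σ φ).toReal * (mFact α : ℝ) ^ σ := by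
  have := (hφ.integrable_and_integral_le α 0).2
  simpa [mPow_zero, mFact] using this

theorem IsGelfandShilov.integrable_mPow_mul (hφ : IsGelfandShilov σ φ) (β : Fin n → ℕ) :
    Integrable fun x => (mPow x β : ℂ) * φ x := by
  have := (hφ.integrable_and_integral_le 0 β).1
  refine this.mono' ?_ (.of_forall fun x => ?_)
  · exact ((Complex.continuous_ofReal.comp (continuous_mPow β)).mul
      hφ.1.continuous).aestronglyMeasurable
  · simp

/-- The multi-index counting how often each coordinate occurs in `p`. -/
def multiCount {k : ℕ} (p : Fin k → Fin n) : Fin n → ℕ :=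
  fun i => (Finset.univ.filter fun j => p j = i).card

theorem prod_coord_eq_mPow {k : ℕ} (p : Fin k → Fin n) (z : EuclideanSpace ℝ (Fin n)) :
    ∏ j, z (p j) = mPow z (multiCount p) := by
  rw [mPow, ← Finset.prod_fiberwise' Finset.univ p]
  simp [multiCount]

theorem mLen_multiCount {k : ℕ} (p : Fin k → Fin n) : mLen (multiCount p) = k := by
  unfold mLen multiCount
  rw [← Finset.card_eq_sum_card_fiberwise (fun _ _ => Finset.mem_coe.2 (Finset.mem_univ _))]
  simp

theorem norm_le_sum_abs (z : EuclideanSpace ℝ (Fin n)) : ‖z‖ ≤ ∑ i, |z i| := by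
  have h : z = ∑ i, z i • EuclideanSpace.single i (1 : ℝ) := by
    ext j
    simp [Finset.sum_apply, Pi.single_apply]
  calc ‖z‖ = ‖∑ i, z i • EuclideanSpace.single i (1 : ℝ)‖ := by rw [← h]
    _ ≤ ∑ i, ‖z i • EuclideanSpace.single i (1 : ℝ)‖ := norm_sum_le _ _
    _ = ∑ i, |z i| := by simp [norm_smul]

/-- Expanding (∑|z_i|)^k ≥ ‖z‖^k leaves finitely many monomial moments. -/
theorem IsGelfandShilov.integrable_norm_pow_mul (hφ : IsGelfandShilov σ φ) (k : ℕ) :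
    Integrable fun z => ‖z‖ ^ k * ‖φ z‖ := by
  have h : Integrable fun z => ∑ p : Fin k → Fin n, |mPow z (multiCount p)| * ‖φ z‖ :=
    integrable_finsetSum _ fun p _ => by
      simpa using (hφ.integrable_and_integral_le 0 (multiCount p)).1
  refine h.mono' ?_ (.of_forall fun z => ?_)
  · exact ((continuous_norm.pow k).mul hφ.1.continuous.norm).aestronglyMeasurable
  · rw [Real.norm_of_nonneg (by positivity), ← Finset.sum_mul]
    refine mul_le_mul_of_nonneg_right ?_ (norm_nonneg _)
    calc ‖z‖ ^ k ≤ (∑ i, |z i|) ^ k := pow_le_pow_left₀ (norm_nonneg _) (norm_le_sum_abs z) k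
      _ = ∑ p : Fin k → Fin n, |mPow z (multiCount p)| := by
        rw [Fintype.sum_pow]
        simp [← prod_coord_eq_mPow, Finset.abs_prod]

/-- The link between Taylor terms, given as multilinear maps on the diagonal, and the monomial
moments of φ. -/
theorem multilinear_diag_apply {k : ℕ}
    (L : ContinuousMultilinearMap ℝ (fun _ : Fin k => EuclideanSpace ℝ (Fin n)) ℂ)
    (z : EuclideanSpace ℝ (Fin n)) :
    L (fun _ => z) = ∑ p : Fin k → Fin n,
      (mPow z (multiCount p) : ℂ) * L fun j => EuclideanSpace.single (p j) 1 := by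
  have h : z = ∑ i, z i • EuclideanSpace.single i (1 : ℝ) := by
    ext j
    simp [Finset.sum_apply, Pi.single_apply]
  calc L (fun _ => z) = L fun _ : Fin k => ∑ i, z i • EuclideanSpace.single i (1 : ℝ) := by
        rw [← h]
    _ = _ := by
      rw [L.map_sum]
      refine Finset.sum_congr rfl fun p _ => ?_
      rw [L.map_smul_univ (fun j => z (p j)), prod_coord_eq_mPow, Complex.real_smul]

theorem IsGelfandShilov.integrable_multilinear_mul (hφ : IsGelfandShilov σ φ) {k : ℕ}
    (L : ContinuousMultilinearMap ℝ (fun _ : Fin k => EuclideanSpace ℝ (Fin n)) ℂ) :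
    Integrable fun z => L (fun _ => z) * φ z := by
  simp only [multilinear_diag_apply L, Finset.sum_mul]
  refine integrable_finsetSum _ fun p _ => ?_
  refine ((hφ.integrable_mPow_mul (multiCount p)).const_mul
    (L fun j => EuclideanSpace.single (p j) 1)).congr (.of_forall fun z => ?_)
  simp only
  ring

theorem IsMollifier.integral_multilinear_mul (hφ : IsMollifier σ φ) {k : ℕ} (hk : k ≠ 0)
    (L : ContinuousMultilinearMap ℝ (fun _ : Fin k => EuclideanSpace ℝ (Fin n)) ℂ) :
    ∫ z, L (fun _ => z) * φ z = 0 := by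
  have h (p : Fin k → Fin n) (z : EuclideanSpace ℝ (Fin n)) :
      (mPow z (multiCount p) : ℂ) * (L fun j => EuclideanSpace.single (p j) 1) * φ z =
        (L fun j => EuclideanSpace.single (p j) 1) * ((mPow z (multiCount p) : ℂ) * φ z) := by
    ring
  simp only [multilinear_diag_apply L, Finset.sum_mul, h]
  rw [integral_finsetSum _ fun p _ => (hφ.1.integrable_mPow_mul (multiCount p)).const_mul _]
  refine Finset.sum_eq_zero fun p _ => ?_
  rw [integral_const_mul, hφ.2.2, mul_zero]
  -- The multi-index counting `k` coordinates has length `k`, so it is zero only for `k = 0`.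
  intro h0
  apply hk
  rw [← mLen_multiCount p, h0, mLen_zero]

end Moments

/-! ### Taylor expansion with a uniform remainder. -/

section Taylor

variable {E F : Type*} [NormedAddCommGroup E] [NormedSpace ℝ E] [NormedAddCommGroup F]
  [NormedSpace ℝ F]

theorem iteratedDeriv_comp_line {v : E → F} (hv : ContDiff ℝ ∞ v) (x h : E) (k : ℕ) (t : ℝ) :
    iteratedDeriv k (fun s : ℝ => v (x + s • h)) t =
      iteratedFDeriv ℝ k v (x + t • h) fun _ => h := by
  have h1 : ContDiff ℝ ∞ fun y => v (x + y) := hv.comp (contDiff_const.add contDiff_id)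
  have h2 := (ContinuousLinearMap.toSpanSingleton ℝ h).iteratedFDeriv_comp_right
    (contDiff_infty.1 h1 k) t (i := k) le_rfl
  rw [iteratedDeriv_eq_iteratedFDeriv]
  change iteratedFDeriv ℝ k ((fun y => v (x + y)) ∘ ContinuousLinearMap.toSpanSingleton ℝ h) t _ = _
  rw [h2, iteratedFDeriv_comp_add_left]
  simp

/-- One-variable Taylor on [0,1] for s ↦ v(x + s h). The constant is uniform in x because the
derivative of order m + 1 is bounded, being continuous with compact support. -/
theorem exists_taylor_bound_of_hasCompactSupport {v : E → F} (hv : ContDiff ℝ ∞ v)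
    (hvc : HasCompactSupport v) (m : ℕ) : ∃ C : ℝ, 0 < C ∧ ∀ x h : E,
      ‖v (x + h) - ∑ k ∈ Finset.range (m + 1),
        ((k.factorial : ℝ)⁻¹) • iteratedFDeriv ℝ k v x (fun _ => h)‖ ≤ C * ‖h‖ ^ (m + 1) := by
  obtain ⟨A, hA⟩ := (hvc.iteratedFDeriv (𝕜 := ℝ) (m + 1)).exists_bound_of_continuous
    (hv.continuous_iteratedFDeriv (m := m + 1) (by exact_mod_cast le_top))
  refine ⟨max A 1, by positivity, fun x h => ?_⟩
  have hf : ContDiff ℝ ∞ fun s : ℝ => v (x + s • h) :=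
    hv.comp (contDiff_const.add (contDiff_id.smul contDiff_const))
  have hu : UniqueDiffOn ℝ (Icc (0 : ℝ) 1) := uniqueDiffOn_Icc zero_lt_one
  have hder (k : ℕ) (t : ℝ) (ht : t ∈ Icc (0 : ℝ) 1) :
      iteratedDerivWithin k (fun s : ℝ => v (x + s • h)) (Icc 0 1) t =
        iteratedFDeriv ℝ k v (x + t • h) fun _ => h := by
    rw [iteratedDerivWithin_eq_iteratedDeriv hu (contDiff_infty.1 hf k).contDiffAt ht,
      iteratedDeriv_comp_line hv]
  have hb := taylor_mean_remainder_bound (f := fun s : ℝ => v (x + s • h)) (a := 0) (b := 1)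
    (x := 1) (n := m) (C := max A 1 * ‖h‖ ^ (m + 1)) zero_le_one
    (by exact_mod_cast (contDiff_infty.1 hf (m + 1)).contDiffOn) (by simp) (fun t ht => by
      rw [hder _ t ht]
      refine ((iteratedFDeriv ℝ (m + 1) v _).le_opNorm _).trans ?_
      simp only [Finset.prod_const, Finset.card_univ, Fintype.card_fin]
      gcongr
      exact (hA _).trans (le_max_left _ _))
  rw [taylor_within_apply, Finset.sum_congr rfl fun k _ => by
    rw [hder k 0 (by simp)]] at hb
  simp only [one_smul, sub_zero, one_pow, mul_one, zero_smul, add_zero] at hb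
  refine hb.trans (div_le_self (by positivity) ?_)
  exact_mod_cast m.factorial_pos

end Taylor

/-! ### Estimates for the truncated mollifiers ρ_ε. -/

section Rho

variable {n : ℕ} {σ : ℝ} {φ : EuclideanSpace ℝ (Fin n) → ℂ} {χ : EuclideanSpace ℝ (Fin n) → ℝ}
  {ε : ℝ}

theorem abs_log_le_inv (hε : ε ∈ Ioc (0 : ℝ) 1) : |Real.log ε| ≤ ε⁻¹ := by
  have h := Real.abs_log_mul_self_lt ε hε.1 hε.2
  rw [abs_mul, abs_of_pos hε.1] at h
  rw [← one_div, le_div_iff₀ hε.1]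
  exact h.le

/-- This is |t log t| < 1 at t = √ε; the 4 comes from log √ε = (log ε)/2. -/
theorem mul_abs_log_sq_le (hε : ε ∈ Ioc (0 : ℝ) 1) : ε * |Real.log ε| ^ 2 ≤ 4 := by
  have hs : 0 < √ε := Real.sqrt_pos.2 hε.1
  have h := Real.abs_log_mul_self_lt (√ε) hs (Real.sqrt_le_one.2 hε.2)
  have h2 : (Real.log √ε * √ε) ^ 2 ≤ 1 := (sq_le_one_iff_abs_le_one _).2 h.le
  rw [Real.log_sqrt hε.1.le, mul_pow, Real.sq_sqrt hε.1.le] at h2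
  rw [sq_abs]
  nlinarith

theorem mul_abs_log_pow_le (hε : ε ∈ Ioc (0 : ℝ) 1) (q : ℕ) :
    (|Real.log ε| * ε) ^ (2 * q) ≤ 4 ^ q * ε ^ q := by
  have h : (|Real.log ε| * ε) ^ 2 ≤ 4 * ε := by
    have := mul_le_mul_of_nonneg_right (mul_abs_log_sq_le hε) hε.1.le
    nlinarith
  rw [pow_mul, ← mul_pow]
  exact pow_le_pow_left₀ (by positivity) h q

theorem IsCutoff.tsupport_subset (hχ : IsCutoff σ χ) : tsupport χ ⊆ Metric.closedBall 0 2 := by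
  refine closure_minimal (fun x hx => ?_) Metric.isClosed_closedBall
  by_contra h
  exact hx (hχ.2.2.1 x (by simpa using (not_le.1 fun h' => h (by simpa using h')).le))

/-- The Gevrey bound on the ball of radius 2 is global, since all derivatives vanish outside. `1 ≤
B` later allows exponents of `B` to be raised. -/
theorem IsCutoff.exists_bound (hχ : IsCutoff σ χ) : ∃ B : ℝ, 1 ≤ B ∧ ∀ α x,
    |mDeriv α χ x| ≤ B ^ (mLen α + 1) * (mFact α : ℝ) ^ σ := by
  obtain ⟨C, hC, h⟩ := hχ.1.2 _ (isCompact_closedBall 0 2)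
  refine ⟨max C 1, le_max_right _ _, fun α x => ?_⟩
  have hpos := mFact_rpow_pos α σ
  by_cases hx : x ∈ Metric.closedBall (0 : EuclideanSpace ℝ (Fin n)) 2
  · refine (h α x hx).trans ?_
    gcongr
    exact le_max_left _ _
  · rw [image_eq_zero_of_notMem_tsupport
      fun h => hx (hχ.tsupport_subset (tsupport_mDeriv_subset hχ.1.1 α h))]
    simp only [abs_zero]
    positivity

/-- The left side vanishes on the unit ball and is at most 1 ≤ ‖x‖^p elsewhere. Thus truncation
costs any desired power of the scale, paid for by a moment of φ. -/
theorem IsCutoff.abs_sub_one_le (hχ : IsCutoff σ χ) (p : ℕ) (x : EuclideanSpace ℝ (Fin n)) :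
    |χ x - 1| ≤ ‖x‖ ^ p := by
  rcases le_total ‖x‖ 1 with h | h
  · rw [hχ.2.2.2 x h]
    simp
  · refine le_trans ?_ (one_le_pow₀ h)
    obtain ⟨h0, h1⟩ := hχ.2.1 x
    rw [abs_le]
    constructor <;> linarith

theorem contDiff_rho (hφ : ContDiff ℝ ∞ φ) (hχ : ContDiff ℝ ∞ χ) (ε : ℝ) :
    ContDiff ℝ ∞ (rho φ χ ε) :=
  (contDiff_const.mul (hφ.comp (contDiff_const_smul _))).mul
    (Complex.ofRealCLM.contDiff.comp (hχ.comp (contDiff_const_smul _)))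

theorem rho_eq_mul (φ : EuclideanSpace ℝ (Fin n) → ℂ) (χ : EuclideanSpace ℝ (Fin n) → ℝ) (ε : ℝ) :
    rho φ χ ε = fun x => ((ε ^ n)⁻¹ • φ (ε⁻¹ • x)) * ((χ (|Real.log ε| • x) : ℝ) : ℂ) := by
  funext x
  simp [rho]

theorem support_rho_subset (hχ : IsCutoff σ χ) (hε : ε ∈ Ioc (0 : ℝ) (Real.exp (-1))) :
    Function.support (rho φ χ ε) ⊆ Metric.closedBall 0 2 := by
  intro x hx
  have hlog : 1 ≤ |Real.log ε| := by
    have := Real.log_le_log hε.1 hε.2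
    rw [Real.log_exp] at this
    rw [abs_of_neg (by linarith)]
    linarith
  by_contra h
  apply hx
  have h2 : 2 < ‖x‖ := by simpa using h
  have : χ (|Real.log ε| • x) = 0 := by
    refine hχ.2.2.1 _ ?_
    rw [norm_smul, Real.norm_eq_abs, abs_abs]
    nlinarith
  simp [rho, this]

theorem exists_integral_mDeriv_rho_le (hφ : IsGelfandShilov σ φ) (hσ : 0 ≤ σ)
    (hχ : IsCutoff σ χ) : ∃ c : ℝ, 0 < c ∧ ∀ α, ∀ ε ∈ Ioc (0 : ℝ) 1,
      Integrable (mDeriv α (rho φ χ ε)) ∧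
        ∫ x, ‖mDeriv α (rho φ χ ε) x‖ ≤
          c ^ (mLen α + 1) * (mFact α : ℝ) ^ σ * ε⁻¹ ^ mLen α := by
  obtain ⟨B, hB1, hB⟩ := hχ.exists_bound
  set M : ℝ := max (gsNorm 1 σ φ).toReal 1 with hM
  have hM1 : 1 ≤ M := le_max_right _ _
  have hB0 : 0 < B := by linarith
  -- `M` bounds the Gelfand–Shilov norm, `B` the cut-off, and 2 accounts for the 2^|α| Leibniz
  -- terms.
  refine ⟨M * (2 * B), by positivity, fun α ε hε => ?_⟩
  have hε0 : 0 < ε := hε.1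
  obtain ⟨ι, _, a, b, hcard, hab, H⟩ := exists_mDeriv_mul α
  set f : EuclideanSpace ℝ (Fin n) → ℂ := fun x => (ε ^ n)⁻¹ • φ (ε⁻¹ • x) with hf
  set g : EuclideanSpace ℝ (Fin n) → ℂ := fun x => ((χ (|Real.log ε| • x) : ℝ) : ℂ) with hg
  have hφs : ContDiff ℝ ∞ fun x => φ (ε⁻¹ • x) := hφ.1.comp (contDiff_const_smul _)
  have hχs : ContDiff ℝ ∞ fun x => χ (|Real.log ε| • x) := hχ.1.1.comp (contDiff_const_smul _)
  have hfs : ContDiff ℝ ∞ f := hφs.const_smul _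
  have hgs : ContDiff ℝ ∞ g := Complex.ofRealCLM.contDiff.comp hχs
  have hdf (β : Fin n → ℕ) : mDeriv β f =
      fun x => (ε ^ n)⁻¹ • ε⁻¹ ^ mLen β • mDeriv β φ (ε⁻¹ • x) := by
    rw [hf, mDeriv_const_smul hφs, mDeriv_comp_smul hφ.1]
  have hif (β : Fin n → ℕ) : Integrable (mDeriv β f) := by
    rw [hdf]
    exact Integrable.smul ((ε ^ n)⁻¹) (Integrable.smul (ε⁻¹ ^ mLen β)
      ((hφ.integrable_mDeriv β).comp_smul (inv_ne_zero hε0.ne')))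
  -- The Jacobian ε^n cancels the normalising factor, so only the derivatives cost powers of ε⁻¹.
  have hnf (β : Fin n → ℕ) : ∫ x, ‖mDeriv β f x‖ ≤ ε⁻¹ ^ mLen β * (M * (mFact β : ℝ) ^ σ) := by
    rw [hdf]
    simp only [norm_smul, integral_const_mul]
    rw [Measure.integral_comp_inv_smul_of_nonneg volume (fun x => ‖mDeriv β φ x‖) hε0.le,
      finrank_euclideanSpace_fin, Real.norm_of_nonneg (by positivity),
      Real.norm_of_nonneg (by positivity), smul_eq_mul]
    calc (ε ^ n)⁻¹ * (ε⁻¹ ^ mLen β * (ε ^ n * ∫ x, ‖mDeriv β φ x‖))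
        = ε⁻¹ ^ mLen β * ∫ x, ‖mDeriv β φ x‖ := by field_simp
      _ ≤ ε⁻¹ ^ mLen β * (M * (mFact β : ℝ) ^ σ) := by
        gcongr
        refine (hφ.integral_mDeriv_le β).trans ?_
        gcongr
        exact le_max_left _ _
  have hng (γ : Fin n → ℕ) (x) :
      ‖mDeriv γ g x‖ ≤ ε⁻¹ ^ mLen γ * (B ^ (mLen γ + 1) * (mFact γ : ℝ) ^ σ) := by
    rw [hg, mDeriv_ofReal hχs, mDeriv_comp_smul hχ.1.1, Complex.norm_real, norm_smul, norm_pow,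
      Real.norm_eq_abs, abs_abs, Real.norm_eq_abs]
    gcongr
    · exact abs_log_le_inv hε
    · exact hB γ _
  have hint (k : ι) : Integrable fun x => mDeriv (a k) f x * mDeriv (b k) g x :=
    (hif (a k)).mul_bdd (contDiff_mDeriv hgs _).continuous.aestronglyMeasurable
      (.of_forall (hng (b k)))
  have hterm (k : ι) : ∫ x, ‖mDeriv (a k) f x * mDeriv (b k) g x‖ ≤
      M * B ^ (mLen α + 1) * (mFact α : ℝ) ^ σ * ε⁻¹ ^ mLen α := by
    have hlen : mLen α = mLen (a k) + mLen (b k) := by rw [← hab k, mLen_add]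
    calc ∫ x, ‖mDeriv (a k) f x * mDeriv (b k) g x‖
        ≤ ∫ x, ‖mDeriv (a k) f x‖ *
            (ε⁻¹ ^ mLen (b k) * (B ^ (mLen (b k) + 1) * (mFact (b k) : ℝ) ^ σ)) := by
          refine integral_mono (hint k).norm ((hif (a k)).norm.mul_const _) fun x => ?_
          simp only [norm_mul]
          gcongr
          exact hng (b k) x
      _ ≤ (ε⁻¹ ^ mLen (a k) * (M * (mFact (a k) : ℝ) ^ σ)) *
            (ε⁻¹ ^ mLen (b k) * (B ^ (mLen (b k) + 1) * (mFact (b k) : ℝ) ^ σ)) := by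
          rw [integral_mul_const]
          gcongr
          exact hnf (a k)
      _ = M * B ^ (mLen (b k) + 1) * ((mFact (a k) : ℝ) * mFact (b k)) ^ σ * ε⁻¹ ^ mLen α := by
          rw [Real.mul_rpow (by positivity) (by positivity), hlen, pow_add]
          ring
      _ ≤ M * B ^ (mLen α + 1) * (mFact α : ℝ) ^ σ * ε⁻¹ ^ mLen α := by
          gcongr
          · omega
          · rw [← hab k]
            exact_mod_cast mFact_mul_le (a k) (b k)
  have hρ : mDeriv α (rho φ χ ε) = fun x => ∑ k, mDeriv (a k) f x * mDeriv (b k) g x := by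
    rw [rho_eq_mul]
    exact H f g hfs hgs
  rw [hρ]
  refine ⟨integrable_finsetSum _ fun k _ => hint k, ?_⟩
  calc ∫ x, ‖∑ k, mDeriv (a k) f x * mDeriv (b k) g x‖
      ≤ ∫ x, ∑ k, ‖mDeriv (a k) f x * mDeriv (b k) g x‖ :=
        integral_mono (integrable_finsetSum _ fun k _ => hint k).norm
          (integrable_finsetSum _ fun k _ => (hint k).norm) fun x => norm_sum_le _ _
    _ = ∑ k, ∫ x, ‖mDeriv (a k) f x * mDeriv (b k) g x‖ :=
        integral_finsetSum _ fun k _ => (hint k).norm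
    _ ≤ ∑ _k : ι, M * B ^ (mLen α + 1) * (mFact α : ℝ) ^ σ * ε⁻¹ ^ mLen α :=
        Finset.sum_le_sum fun k _ => hterm k
    _ = 2 ^ mLen α * M * B ^ (mLen α + 1) * (mFact α : ℝ) ^ σ * ε⁻¹ ^ mLen α := by
        rw [Finset.sum_const, Finset.card_univ, hcard, nsmul_eq_mul]
        push_cast
        ring
    _ ≤ 2 ^ (mLen α + 1) * M ^ (mLen α + 1) * B ^ (mLen α + 1) * (mFact α : ℝ) ^ σ *
          ε⁻¹ ^ mLen α := by
        gcongr
        · norm_num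
        · omega
        · exact le_self_pow₀ hM1 (by omega)
    _ = (M * (2 * B)) ^ (mLen α + 1) * (mFact α : ℝ) ^ σ * ε⁻¹ ^ mLen α := by
        rw [mul_pow, mul_pow]
        ring

theorem conv_rho_apply (u : EuclideanSpace ℝ (Fin n) → ℂ) (φ : EuclideanSpace ℝ (Fin n) → ℂ)
    (χ : EuclideanSpace ℝ (Fin n) → ℝ) (hε : 0 < ε) (x : EuclideanSpace ℝ (Fin n)) :
    conv u (rho φ χ ε) x =
      ∫ z, u (x - ε • z) * ((χ ((|Real.log ε| * ε) • z) : ℝ) : ℂ) * φ z := by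
  have h := Measure.integral_comp_inv_smul_of_nonneg volume
    (fun z => u (x - ε • z) * ((χ ((|Real.log ε| * ε) • z) : ℝ) : ℂ) * φ z) hε.le
  simp only [smul_smul, mul_assoc, mul_inv_cancel₀ hε.ne', one_smul, mul_one,
    finrank_euclideanSpace_fin] at h
  rw [conv_apply_swap]
  have h3 : ∫ z, u (x - ε • z) * ((χ ((|Real.log ε| * ε) • z) : ℝ) : ℂ) * φ z =
      (ε ^ n)⁻¹ • ∫ y, u (x - y) * (((χ (|Real.log ε| • y) : ℝ) : ℂ) * φ (ε⁻¹ • y)) := by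
    rw [h, inv_smul_smul₀ (by positivity)]
    simp only [mul_assoc]
  rw [h3, ← integral_smul]
  congr 1
  funext y
  simp only [rho, Complex.real_smul]
  ring

theorem exists_norm_conv_rho_sub_le (hφ : IsMollifier σ φ) (hχ : IsCutoff σ χ)
    {v : EuclideanSpace ℝ (Fin n) → ℂ} (hv : ContDiff ℝ ∞ v) (hvc : HasCompactSupport v) (q : ℕ) :
    ∃ c : ℝ, 0 < c ∧ ∀ x, ∀ ε ∈ Ioc (0 : ℝ) 1,
      ‖conv v (rho φ χ ε) x - v x‖ ≤ c * ε ^ q := by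
  obtain ⟨A, hA0, hA⟩ := exists_norm_le_of_hasCompactSupport hv.continuous hvc
  obtain ⟨C, hC0, hC⟩ := exists_taylor_bound_of_hasCompactSupport hv hvc q
  have hI1 := hφ.1.integrable_norm_pow_mul (q + 1)
  have hI2 := hφ.1.integrable_norm_pow_mul (2 * q)
  set J1 := ∫ z, ‖z‖ ^ (q + 1) * ‖φ z‖ with hJ1
  set J2 := ∫ z, ‖z‖ ^ (2 * q) * ‖φ z‖ with hJ2
  have hJ1n : 0 ≤ J1 := integral_nonneg fun z => by positivity
  have hJ2n : 0 ≤ J2 := integral_nonneg fun z => by positivity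
  refine ⟨C * J1 + A * 4 ^ q * J2 + 1, by positivity, fun x ε hε => ?_⟩
  have hε0 := hε.1
  -- The Taylor term of order `k` of v(x − εz), as a multilinear map in z.
  let L (k : ℕ) : ContinuousMultilinearMap ℝ (fun _ : Fin k => EuclideanSpace ℝ (Fin n)) ℂ :=
    (((k.factorial : ℝ)⁻¹) * (-ε) ^ k) • iteratedFDeriv ℝ k v x
  have hL (k : ℕ) (z : EuclideanSpace ℝ (Fin n)) : L k (fun _ => z) =
      ((k.factorial : ℝ)⁻¹) • iteratedFDeriv ℝ k v x (fun _ => -(ε • z)) := by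
    have := (iteratedFDeriv ℝ k v x).map_smul_univ (fun _ => -ε) (fun _ => z)
    simp only [Finset.prod_const, Finset.card_univ, Fintype.card_fin] at this
    simp only [L, smul_apply, mul_smul, ← this, neg_smul]
  have hLint (k : ℕ) : Integrable fun z => L k (fun _ => z) * φ z :=
    hφ.1.integrable_multilinear_mul (L k)
  have hT : ∫ z, (∑ k ∈ Finset.range (q + 1), L k fun _ => z) * φ z = v x := by
    simp only [Finset.sum_mul]
    rw [integral_finsetSum _ fun k _ => hLint k, Finset.sum_range_succ',
      Finset.sum_eq_zero fun k _ => hφ.integral_multilinear_mul (Nat.succ_ne_zero k) (L (k + 1)),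
      zero_add]
    have h0 (z : EuclideanSpace ℝ (Fin n)) : L 0 (fun _ => z) = v x := by simp [L]
    simp only [h0]
    rw [integral_const_mul, hφ.2.1, mul_one]
  have hTint : Integrable fun z => (∑ k ∈ Finset.range (q + 1), L k fun _ => z) * φ z := by
    simp only [Finset.sum_mul]
    exact integrable_finsetSum _ fun k _ => hLint k
  have hφint : Integrable φ := by simpa using hφ.1.integrable_mDeriv 0
  have hVint : Integrable fun z =>
      v (x - ε • z) * ((χ ((|Real.log ε| * ε) • z) : ℝ) : ℂ) * φ z := by
    refine hφint.bdd_mul (c := A) ?_ (.of_forall fun z => ?_)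
    · have h1 : Continuous fun z => v (x - ε • z) := hv.continuous.comp (by fun_prop)
      have h2 : Continuous fun z => χ ((|Real.log ε| * ε) • z) :=
        hχ.1.1.continuous.comp (by fun_prop)
      exact (h1.mul (Complex.continuous_ofReal.comp h2)).aestronglyMeasurable
    · rw [norm_mul, Complex.norm_real, Real.norm_of_nonneg (hχ.2.1 _).1]
      exact (mul_le_of_le_one_right (norm_nonneg _) (hχ.2.1 _).2).trans (hA _)
  rw [conv_rho_apply v φ χ hε0, ← hT, ← integral_sub hVint hTint]
  -- Taylor remainder plus truncation error. The exponent 2q in the latter leaves ε^q once the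
  -- logarithms are absorbed.
  have hpt (z : EuclideanSpace ℝ (Fin n)) :
      ‖v (x - ε • z) * ((χ ((|Real.log ε| * ε) • z) : ℝ) : ℂ) * φ z -
        (∑ k ∈ Finset.range (q + 1), L k fun _ => z) * φ z‖ ≤
      C * ε ^ (q + 1) * (‖z‖ ^ (q + 1) * ‖φ z‖) +
        A * (|Real.log ε| * ε) ^ (2 * q) * (‖z‖ ^ (2 * q) * ‖φ z‖) := by
    have h1 := hC x (-(ε • z))
    simp only [← hL, ← sub_eq_add_neg, norm_neg, norm_smul, Real.norm_of_nonneg hε0.le,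
      mul_pow] at h1
    have h2 := hχ.abs_sub_one_le (2 * q) ((|Real.log ε| * ε) • z)
    rw [norm_smul, mul_pow, Real.norm_of_nonneg (by positivity)] at h2
    have h3 : ‖v (x - ε • z) * (((χ ((|Real.log ε| * ε) • z) - 1 : ℝ)) : ℂ)‖ ≤
        A * ((|Real.log ε| * ε) ^ (2 * q) * ‖z‖ ^ (2 * q)) := by
      rw [norm_mul, Complex.norm_real, Real.norm_eq_abs]
      exact mul_le_mul (hA _) h2 (abs_nonneg _) hA0.le
    have h4 : v (x - ε • z) * ((χ ((|Real.log ε| * ε) • z) : ℝ) : ℂ) * φ z -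
        (∑ k ∈ Finset.range (q + 1), L k fun _ => z) * φ z =
        ((v (x - ε • z) - ∑ k ∈ Finset.range (q + 1), L k fun _ => z) +
          v (x - ε • z) * (((χ ((|Real.log ε| * ε) • z) - 1 : ℝ)) : ℂ)) * φ z := by
      push_cast
      ring
    rw [h4, norm_mul]
    calc _ ≤ (C * (ε ^ (q + 1) * ‖z‖ ^ (q + 1)) +
          A * ((|Real.log ε| * ε) ^ (2 * q) * ‖z‖ ^ (2 * q))) * ‖φ z‖ := by
          gcongr
          exact (norm_add_le _ _).trans (add_le_add h1 h3)
      _ = _ := by ring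
  refine (norm_integral_le_of_norm_le ((hI1.const_mul _).add (hI2.const_mul _))
    (.of_forall hpt)).trans ?_
  simp only [Pi.add_apply]
  rw [integral_add (hI1.const_mul _) (hI2.const_mul _), integral_const_mul, integral_const_mul,
    ← hJ1, ← hJ2]
  have h5 : ε ^ (q + 1) ≤ ε ^ q := pow_le_pow_of_le_one hε0.le hε.2 (Nat.le_succ q)
  have h6 := mul_abs_log_pow_le hε q
  calc C * ε ^ (q + 1) * J1 + A * (|Real.log ε| * ε) ^ (2 * q) * J2
      ≤ C * ε ^ q * J1 + A * (4 ^ q * ε ^ q) * J2 := by gcongr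
    _ ≤ (C * J1 + A * 4 ^ q * J2 + 1) * ε ^ q := by
      have : 0 < ε ^ q := by positivity
      nlinarith

end Rho

/-! ### From factorial bounds to exponential decay. -/

section Decay

variable {n : ℕ}

/-- With G = (F/c)^{1/σ} and s = (t/c)^{1/σ} the hypothesis reads G s^m ≤ m!. Dividing by 2^m m! and
summing gives G e^{s/2} ≤ ∑ 2^{-m} = 2; the σ-th power of this is the claim. -/
theorem le_exp_of_forall_pow_mul_le {σ c F t : ℝ} (hσ : 0 < σ) (hc : 0 < c) (hF : 0 ≤ F)
    (ht : 0 ≤ t) (h : ∀ m : ℕ, t ^ m * F ≤ c ^ (m + 1) * (m.factorial : ℝ) ^ σ) :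
    F ≤ c * 2 ^ σ * Real.exp (-(σ / 2) * (t / c) ^ (1 / σ)) := by
  set s := (t / c) ^ (1 / σ) with hs
  set G := (F / c) ^ (1 / σ) with hG
  have hs0 : 0 ≤ s := by positivity
  have hG0 : 0 ≤ G := by positivity
  have hsσ : s ^ σ = t / c := by
    rw [hs, ← Real.rpow_mul (by positivity), one_div_mul_cancel hσ.ne', Real.rpow_one]
  have hGσ : G ^ σ = F / c := by
    rw [hG, ← Real.rpow_mul (by positivity), one_div_mul_cancel hσ.ne', Real.rpow_one]
  have hm (m : ℕ) : G * s ^ m ≤ m.factorial := by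
    rw [← Real.rpow_le_rpow_iff (by positivity) (by positivity) hσ,
      Real.mul_rpow hG0 (by positivity), hGσ, ← Real.rpow_natCast s m, ← Real.rpow_mul hs0,
      mul_comm (m : ℝ) σ, Real.rpow_mul hs0, hsσ, Real.rpow_natCast, div_pow, div_mul_div_comm,
      div_le_iff₀ (by positivity)]
    linarith [h m, show c * c ^ m = c ^ (m + 1) by ring,
      show (m.factorial : ℝ) ^ σ * (c * c ^ m) = c ^ (m + 1) * (m.factorial : ℝ) ^ σ by ring]
  have hexp : G * Real.exp (s / 2) ≤ 2 := by
    have h1 : HasSum (fun m : ℕ => G * ((s / 2) ^ m / m.factorial)) (G * Real.exp (s / 2)) := by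
      rw [Real.exp_eq_exp_ℝ]
      exact (NormedSpace.expSeries_div_hasSum_exp (s / 2)).mul_left G
    refine hasSum_le (fun m => ?_) h1 hasSum_geometric_two
    rw [div_pow, one_div, inv_pow, div_div, mul_div_assoc', div_le_iff₀ (by positivity)]
    calc G * s ^ m ≤ m.factorial := hm m
      _ = (2 ^ m)⁻¹ * (2 ^ m * m.factorial) := by field_simp
  have hG2 : G ≤ 2 * Real.exp (-(s / 2)) := by
    rw [Real.exp_neg, ← div_eq_mul_inv, le_div_iff₀ (Real.exp_pos _)]
    exact hexp
  have h3 : F / c ≤ 2 ^ σ * Real.exp (-(σ / 2) * s) := by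
    rw [← hGσ]
    refine (Real.rpow_le_rpow hG0 hG2 hσ.le).trans_eq ?_
    rw [Real.mul_rpow (by norm_num) (Real.exp_pos _).le, ← Real.exp_mul]
    ring_nf
  rw [div_le_iff₀ hc] at h3
  linarith

theorem jap_le_one_add_sum (ξ : EuclideanSpace ℝ (Fin n)) : jap ξ ≤ 1 + ∑ i, |ξ i| := by
  refine le_trans ?_ (add_le_add_right (norm_le_sum_abs ξ) 1)
  unfold jap
  rw [Real.sqrt_le_left (by positivity)]
  nlinarith [norm_nonneg ξ]

theorem rpow_sum_le_sum_rpow {ι : Type*} (s : Finset ι) {f : ι → ℝ} (hf : ∀ i, 0 ≤ f i) {p : ℝ}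
    (hp : 0 < p) (hp1 : p ≤ 1) : (∑ i ∈ s, f i) ^ p ≤ ∑ i ∈ s, f i ^ p := by
  classical
  induction s using Finset.induction_on with
  | empty => simp [hp.ne']
  | insert i s hi ih =>
    rw [Finset.sum_insert hi, Finset.sum_insert hi]
    exact (Real.rpow_add_le_add_rpow (hf i) (Finset.sum_nonneg fun j _ => hf j) hp.le hp1).trans
      (add_le_add_right ih _)

theorem rpow_mul_jap_rpow_le {ε p : ℝ} (hε : ε ∈ Ioc (0 : ℝ) 1) (hp : 0 < p) (hp1 : p ≤ 1)
    (ξ : EuclideanSpace ℝ (Fin n)) :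
    ε ^ p * jap ξ ^ p ≤ 1 + ∑ i, (ε * |ξ i|) ^ p := by
  have hε0 := hε.1.le
  have hj : 0 ≤ jap ξ := Real.sqrt_nonneg _
  have hS : 0 ≤ ∑ i, ε * |ξ i| := Finset.sum_nonneg fun i _ => by positivity
  calc ε ^ p * jap ξ ^ p = (ε * jap ξ) ^ p := (Real.mul_rpow hε0 hj).symm
    _ ≤ (1 + ∑ i, ε * |ξ i|) ^ p := by
      refine Real.rpow_le_rpow (by positivity) ?_ hp.le
      rw [← Finset.mul_sum]
      have := mul_le_mul_of_nonneg_left (jap_le_one_add_sum ξ) hε0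
      linarith [hε.2]
    _ ≤ 1 ^ p + (∑ i, ε * |ξ i|) ^ p := Real.rpow_add_le_add_rpow zero_le_one hS hp.le hp1
    _ ≤ 1 + ∑ i, (ε * |ξ i|) ^ p := by
      rw [Real.one_rpow]
      gcongr
      exact rpow_sum_le_sum_rpow _ (fun i => by positivity) hp hp1

theorem exists_le_exp_neg_jap {σ c : ℝ} (hσ : 1 ≤ σ) (hc : 0 < c) :
    ∃ k : ℝ, 0 < k ∧ ∃ k' : ℝ, 0 < k' ∧ ∀ (ξ : EuclideanSpace ℝ (Fin n)), ∀ ε ∈ Ioc (0 : ℝ) 1,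
      ∀ F : ℝ, 0 ≤ F → F ≤ c →
      (∀ i, ∀ m : ℕ, (ε * |ξ i|) ^ m * F ≤ c ^ (m + 1) * (m.factorial : ℝ) ^ σ) →
      F ≤ k' * Real.exp (-k * ε ^ (1 / σ) * jap ξ ^ (1 / σ)) := by
  have hσ0 : 0 < σ := by linarith
  set r := σ / 2 / c ^ (1 / σ) with hr
  have hr0 : 0 < r := by positivity
  set P := c * 2 ^ σ with hP
  have hP0 : 0 < P := by positivity
  have hcP : c ≤ P := le_mul_of_one_le_right hc.le (Real.one_le_rpow (by norm_num) hσ0.le)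
  set k := r / (n + 1) with hk
  have hk0 : 0 < k := by positivity
  -- The factor e^k absorbs the summand 1 in `rpow_mul_jap_rpow_le`.
  refine ⟨k, hk0, P * Real.exp k, by positivity, fun ξ ε hε F hF hFc h => ?_⟩
  have hε0 := hε.1.le
  have hFi (i : Fin n) : F ≤ P * Real.exp (-(r * (ε * |ξ i|) ^ (1 / σ))) := by
    have := le_exp_of_forall_pow_mul_le hσ0 hc hF (by positivity : 0 ≤ ε * |ξ i|) (h i)
    rw [Real.div_rpow (by positivity) hc.le] at this
    refine this.trans_eq ?_
    rw [hr]
    congr 2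
    ring
  have hFS : F ≤ P * Real.exp (-(k * ∑ i, (ε * |ξ i|) ^ (1 / σ))) := by
    -- For n = 0 there is no coordinate to use, and `F ≤ c` takes over. Otherwise the largest
    -- coordinate dominates the sum up to the factor n + 1.
    rcases isEmpty_or_nonempty (Fin n) with hn | hn
    · simpa using hFc.trans hcP
    · obtain ⟨i, -, hi⟩ := Finset.exists_max_image Finset.univ
        (fun i => (ε * |ξ i|) ^ (1 / σ)) Finset.univ_nonempty
      have hsum : ∑ j, (ε * |ξ j|) ^ (1 / σ) ≤ (n + 1) * (ε * |ξ i|) ^ (1 / σ) := by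
        refine (Finset.sum_le_card_nsmul _ _ _ hi).trans ?_
        rw [Finset.card_univ, Fintype.card_fin, nsmul_eq_mul]
        gcongr
        linarith
      refine (hFi i).trans
        (mul_le_mul_of_nonneg_left (Real.exp_le_exp.2 (neg_le_neg ?_)) hP0.le)
      calc k * ∑ j, (ε * |ξ j|) ^ (1 / σ) ≤ k * ((n + 1) * (ε * |ξ i|) ^ (1 / σ)) := by gcongr
        _ = r * (ε * |ξ i|) ^ (1 / σ) := by rw [hk]; field_simp
  have hp1 : 1 / σ ≤ 1 := by rw [div_le_one hσ0]; exact hσ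
  have hj := rpow_mul_jap_rpow_le hε (by positivity : 0 < 1 / σ) hp1 ξ
  rw [mul_assoc P, ← Real.exp_add]
  refine hFS.trans ?_
  gcongr
  nlinarith [mul_le_mul_of_nonneg_left hj hk0.le]

end Decay

/-! ### Assembly of the moderateness, negligibility and Fourier estimates. -/

section Main

variable {n : ℕ} {σ : ℝ} {φ : EuclideanSpace ℝ (Fin n) → ℂ} {χ : EuclideanSpace ℝ (Fin n) → ℝ}
  {u : EuclideanSpace ℝ (Fin n) → ℂ}

theorem mFact_single (i : Fin n) (m : ℕ) : mFact (Pi.single i m) = m.factorial := by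
  unfold mFact
  rw [Finset.prod_eq_single i (fun j _ hj => by simp [Pi.single_eq_of_ne hj]) (by simp)]
  simp

theorem exists_norm_mDeriv_conv_rho_le (hφ : IsGelfandShilov σ φ) (hσ : 0 ≤ σ)
    (hχ : IsCutoff σ χ) (hu : ContDiff ℝ ∞ u) (huc : HasCompactSupport u) :
    ∃ c : ℝ, 1 ≤ c ∧ ∀ α x, ∀ ε ∈ Ioc (0 : ℝ) 1,
      ‖mDeriv α (conv u (rho φ χ ε)) x‖ ≤
        c ^ (mLen α + 1) * (mFact α : ℝ) ^ σ * ε⁻¹ ^ mLen α := by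
  obtain ⟨A, hA0, hA⟩ := exists_norm_le_of_hasCompactSupport hu.continuous huc
  obtain ⟨c, hc0, hc⟩ := exists_integral_mDeriv_rho_le hφ hσ hχ
  refine ⟨max A 1 * max c 1, one_le_mul_of_one_le_of_one_le (le_max_right _ _) (le_max_right _ _),
    fun α x ε hε => ?_⟩
  have hε0 := hε.1
  rw [mDeriv_conv_right hu huc (contDiff_rho hφ.1 hχ.1.1 ε)]
  obtain ⟨hi, hle⟩ := hc α ε hε
  calc _ ≤ A * (c ^ (mLen α + 1) * (mFact α : ℝ) ^ σ * ε⁻¹ ^ mLen α) :=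
        (norm_conv_le hA hi x).trans (mul_le_mul_of_nonneg_left hle hA0.le)
    _ ≤ max A 1 ^ (mLen α + 1) *
          (max c 1 ^ (mLen α + 1) * (mFact α : ℝ) ^ σ * ε⁻¹ ^ mLen α) := by
        gcongr
        · exact (le_max_left A 1).trans (le_self_pow₀ (le_max_right _ _) (by omega))
        · exact le_max_left _ _
    _ = _ := by rw [mul_pow]; ring

theorem exists_tsupport_conv_rho_subset (hχ : IsCutoff σ χ) (huc : HasCompactSupport u)
    (φ : EuclideanSpace ℝ (Fin n) → ℂ) :
    ∃ K : Set (EuclideanSpace ℝ (Fin n)), IsCompact K ∧ tsupport u ⊆ K ∧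
      ∀ ε ∈ Ioc (0 : ℝ) (Real.exp (-1)), tsupport (conv u (rho φ χ ε)) ⊆ K := by
  open scoped Pointwise in
  refine ⟨tsupport u + Metric.closedBall 0 2, huc.isCompact.add (isCompact_closedBall 0 2),
    fun x hx => ⟨x, hx, 0, by simp, by simp⟩, fun ε hε => ?_⟩
  exact tsupport_conv_subset huc (isCompact_closedBall 0 2) (support_rho_subset hχ hε)

theorem exp_neg_one_mem : Real.exp (-1) ∈ Ioc (0 : ℝ) 1 :=
  ⟨Real.exp_pos _, Real.exp_le_one_iff.2 (by norm_num)⟩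

theorem isGevreyModerate_conv_rho (hφ : IsGelfandShilov σ φ) (hσ : 0 ≤ σ)
    (hχ : IsCutoff σ χ) (hu : ContDiff ℝ ∞ u) (huc : HasCompactSupport u) :
    IsGevreyModerate σ fun ε => conv u (rho φ χ ε) := by
  obtain ⟨c, hc1, hc⟩ := exists_norm_mDeriv_conv_rho_le hφ hσ hχ hu huc
  have hc0 : 0 < c := by linarith
  -- For fixed ε the factor ε^{-|α|} goes into the Gevrey constant; for moderateness N = 0 suffices.
  refine ⟨fun ε hε => ⟨contDiff_conv hu huc (contDiff_rho hφ.1 hχ.1.1 ε).continuous,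
    fun K _ => ⟨c * ε⁻¹, mul_pos hc0 (inv_pos.2 hε.1), fun α x _ => (hc α x ε hε).trans ?_⟩⟩,
    fun K _ => ⟨c, hc0, 0, fun α x _ ε hε => ?_⟩⟩
  · have hε0 := hε.1
    rw [mul_pow, mul_right_comm]
    gcongr
    · exact (one_le_inv₀ hε0).2 hε.2
    · omega
  · have := hc α x ε hε
    simpa [zpow_neg, inv_pow] using this

theorem isSmoothNegligible_conv_rho_sub (hφ : IsMollifier σ φ) (hχ : IsCutoff σ χ)
    (hu : ContDiff ℝ ∞ u) (huc : HasCompactSupport u) :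
    IsSmoothNegligible fun ε x => conv u (rho φ χ ε) x - u x := by
  have hρ (ε : ℝ) : ContDiff ℝ ∞ (rho φ χ ε) := contDiff_rho hφ.1.1 hχ.1.1 ε
  have hs (ε : ℝ) : ContDiff ℝ ∞ (conv u (rho φ χ ε)) := contDiff_conv hu huc (hρ ε).continuous
  refine ⟨fun ε _ => (hs ε).sub hu, fun K _ α q => ?_⟩
  obtain ⟨c, hc0, hc⟩ := exists_norm_conv_rho_sub_le hφ hχ (contDiff_mDeriv hu α)
    (hasCompactSupport_mDeriv hu huc α) q
  refine ⟨c, hc0, fun x _ ε hε => ?_⟩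
  rw [mDeriv_sub (hs ε) hu, mDeriv_conv_left hu huc (hρ ε).continuous]
  exact hc x ε hε

theorem exists_norm_fourierHat_conv_rho_le (hφ : IsGelfandShilov σ φ) (hσ : 1 ≤ σ)
    (hχ : IsCutoff σ χ) (hu : ContDiff ℝ ∞ u) (huc : HasCompactSupport u) :
    ∃ k : ℝ, 0 < k ∧ ∃ k' : ℝ, 0 < k' ∧ ∀ (ξ : EuclideanSpace ℝ (Fin n)),
      ∀ ε ∈ Ioc (0 : ℝ) (Real.exp (-1)),
        ‖fourierHat (conv u (rho φ χ ε)) ξ‖ ≤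
          k' * Real.exp (-k * ε ^ (1 / σ) * jap ξ ^ (1 / σ)) := by
  obtain ⟨c, hc1, hc⟩ := exists_norm_mDeriv_conv_rho_le hφ (by linarith) hχ hu huc
  obtain ⟨K, hK, -, hsupp⟩ := exists_tsupport_conv_rho_subset hχ huc φ
  have hc0 : 0 < c := by linarith
  set V := max (volume.real K) 1 with hV
  have hV1 : 1 ≤ V := le_max_right _ _
  -- The volume of the common support enters once; since V ≥ 1 it is at most V^{m+1} and merges with
  -- the constant.
  obtain ⟨k, hk, k', hk', H⟩ := exists_le_exp_neg_jap (n := n) hσ (by positivity : 0 < c * V)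
  refine ⟨k, hk, k', hk', fun ξ ε hε => ?_⟩
  have hε1 : ε ∈ Ioc (0 : ℝ) 1 := ⟨hε.1, hε.2.trans exp_neg_one_mem.2⟩
  have hε0 := hε.1
  have hs : ContDiff ℝ ∞ (conv u (rho φ χ ε)) :=
    contDiff_conv hu huc (contDiff_rho hφ.1 hχ.1.1 ε).continuous
  have hcs : HasCompactSupport (conv u (rho φ χ ε)) :=
    hK.of_isClosed_subset (isClosed_tsupport _) (hsupp ε hε)
  have hbound (α : Fin n → ℕ) : ‖fourierHat (mDeriv α (conv u (rho φ χ ε))) ξ‖ ≤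
      c ^ (mLen α + 1) * (mFact α : ℝ) ^ σ * ε⁻¹ ^ mLen α * V := by
    refine (norm_fourierHat_le_of_support_subset hK ((tsupport_mDeriv_subset hs α).trans
      (hsupp ε hε)) (fun x => hc α x ε hε1) ξ).trans ?_
    have := mFact_rpow_pos α σ
    gcongr
    exact le_max_left _ _
  refine H ξ ε hε1 _ (norm_nonneg _) ?_ fun i m => ?_
  · simpa [mFact] using hbound 0
  · have h := hbound (Pi.single i m)
    rw [mDeriv_single hs, fourierHat_pDeriv_iterate hs hcs, mLen_single, mFact_single, norm_mul,
      norm_pow, norm_mul, Complex.norm_I, one_mul, Complex.norm_real, Real.norm_eq_abs] at h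
    calc (ε * |ξ i|) ^ m * ‖fourierHat (conv u (rho φ χ ε)) ξ‖
        = ε ^ m * (|ξ i| ^ m * ‖fourierHat (conv u (rho φ χ ε)) ξ‖) := by rw [mul_pow]; ring
      _ ≤ ε ^ m * (c ^ (m + 1) * (m.factorial : ℝ) ^ σ * ε⁻¹ ^ m * V) := by gcongr
      _ = c ^ (m + 1) * (m.factorial : ℝ) ^ σ * V := by
        have : ε ^ m * ε⁻¹ ^ m = 1 := by rw [← mul_pow, mul_inv_cancel₀ hε0.ne', one_pow]
        linear_combination c ^ (m + 1) * (m.factorial : ℝ) ^ σ * V * this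
      _ ≤ c ^ (m + 1) * (m.factorial : ℝ) ^ σ * V ^ (m + 1) := by
        gcongr
        exact le_self_pow₀ hV1 (by omega)
      _ = (c * V) ^ (m + 1) * (m.factorial : ℝ) ^ σ := by rw [mul_pow]; ring

end Main

end GevreyReg

theorem mainTheorem9 (n : ℕ) (σ : ℝ) (hσ : 1 < σ)
    (φ : EuclideanSpace ℝ (Fin n) → ℂ) (hφ : GevreyReg.IsMollifier σ φ)
    (χ : EuclideanSpace ℝ (Fin n) → ℝ) (hχ : GevreyReg.IsCutoff σ χ)
    (u : EuclideanSpace ℝ (Fin n) → ℂ) (hu : ContDiff ℝ ∞ u) (huc : HasCompactSupport u) :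
    GevreyReg.UniformCompactSupport (fun ε => GevreyReg.conv u (GevreyReg.rho φ χ ε)) ∧
    ((∃ c : ℝ, 0 < c ∧ ∃ η ∈ Ioc (0 : ℝ) 1,
        ∀ (α : Fin n → ℕ) (x : EuclideanSpace ℝ (Fin n)), ∀ ε ∈ Ioc (0 : ℝ) η,
          ‖GevreyReg.mDeriv α (GevreyReg.conv u (GevreyReg.rho φ χ ε)) x‖ ≤
            c ^ (GevreyReg.mLen α + 1) * (GevreyReg.mFact α : ℝ) ^ σ *
              ε ^ (-(GevreyReg.mLen α : ℤ))) ∧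
      GevreyReg.IsGevreyModerateC σ (fun ε => GevreyReg.conv u (GevreyReg.rho φ χ ε))) ∧
    (GevreyReg.UniformCompactSupport
        (fun ε x => GevreyReg.conv u (GevreyReg.rho φ χ ε) x - u x) ∧
      GevreyReg.IsSmoothNegligible
        (fun ε x => GevreyReg.conv u (GevreyReg.rho φ χ ε) x - u x)) ∧
    (∃ c : ℝ, 0 < c ∧ ∃ c' : ℝ, 0 < c' ∧ ∃ η ∈ Ioc (0 : ℝ) 1,
      ∀ (ξ : EuclideanSpace ℝ (Fin n)), ∀ ε ∈ Ioc (0 : ℝ) η,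
        ‖GevreyReg.fourierHat (GevreyReg.conv u (GevreyReg.rho φ χ ε)) ξ‖ ≤
          c' * Real.exp (-c * ε ^ (1 / σ) * GevreyReg.jap ξ ^ (1 / σ))) := by
  open GevreyReg in
  have hσ0 : 0 ≤ σ := by linarith
  obtain ⟨K, hK, huK, hsupp⟩ := exists_tsupport_conv_rho_subset hχ huc φ
  have hU : UniformCompactSupport (fun ε => conv u (rho φ χ ε)) :=
    ⟨K, hK, _, exp_neg_one_mem, hsupp⟩
  obtain ⟨c, hc1, hc⟩ := exists_norm_mDeriv_conv_rho_le hφ.1 hσ0 hχ hu huc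
  obtain ⟨k, hk, k', hk', H⟩ := exists_norm_fourierHat_conv_rho_le hφ.1 hσ.le hχ hu huc
  -- Here η = 1 works. The threshold e⁻¹, where |log ε| ≥ 1, matters only for supports and hence for
  -- the Fourier bound.
  refine ⟨hU, ⟨⟨c, by linarith, 1, by simp, fun α x ε hε => ?_⟩,
    isGevreyModerate_conv_rho hφ.1 hσ0 hχ hu huc, hU⟩,
    ⟨⟨K, hK, _, exp_neg_one_mem, fun ε hε => ?_⟩, isSmoothNegligible_conv_rho_sub hφ hχ hu huc⟩,
    k, hk, k', hk', _, exp_neg_one_mem, H⟩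
  · simpa [zpow_neg, inv_pow] using hc α x ε hε
  · exact (tsupport_sub _ _).trans (union_subset (hsupp ε hε) huK)
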